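/- Setting. Let $n\ge 1$, let $\mathcal X,\mathcal Z$ be real Banach spaces with $\mathcal X$ continuously and densely embedded in $\mathcal Z$, let $U\subset\mathcal X$ and $V\subset\mathbb R^n$ be open, and let $F:U\times V\to\mathcal Z$ be real analytic. For $(x;\epsilon)\in U\times V$ let $A(x;\epsilon)$ be the complexification of the Fréchet derivative $D_xF(x;\epsilon)\in\mathcal L(\mathcal X,\mathcal Z)$, considered as an operator in the complexification $\mathcal Z_{\mathbb C}$ with domain $\mathcal X_{\mathbb C}$; $\sigma(\cdot)$ and $\rho(\cdot)$ denote spectrum and resolvent set. An isolated eigenvalue is simple if its algebraic multiplicity (the dimension of the range of its Riesz projection) is $1$. A point $(x;\epsilon)\in U\times V$ is an equilibrium point if $F(x;\epsilon)=0$. An equilibrium point is $\sigma(A)$-critical if $\sigma(A(x;\epsilon))\subset\{\operatorname{Re}\zeta\le 0\}$ and $\sigma(A(x;\epsilon))\cap i\mathbb R$ consists of two complex conjugate simple isolated eigenvalues $\lambda_0^{\pm}$ with $\operatorname{Im}\lambda_0^+=-\operatorname{Im}\lambda_0^->0$. For $\omega\in(0,\pi/2]$, $\mathbb H(\omega,0)$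 is the class of densely defined closed operators $T$ such that the sector $\Sigma_{\pi/2+\omega}=\{\zeta\ne0:|\arg\zeta|<\pi/2+\omega\}$ is contained in $\rho(T)$ and for every $\omega'\in[0,\omega)$ there is $M_{\omega'}>0$ with $\|(T-\zeta I)^{-1}\|\le M_{\omega'}/|\zeta|$ for all $\zeta\in\Sigma_{\pi/2+\omega'}$. An operator is $\mathbb H$-sectorial if it equals $T_0+\zeta_0 I$ for some $\zeta_0\in\mathbb R$, $\omega\in(0,\pi/2]$ and $T_0\in\mathbb H(\omega,0)$. Let $(x^0;\epsilon^0)$ be a $\sigma(A)$-critical equilibrium point. By a local parametrization at $(x^0;\epsilon^0)$ we mean a real analytic map $X^{\mathrm{loc}}:\mathcal N^{\epsilon^0}\to\mathcal N^{x^0}$ with $X^{\mathrm{loc}}(\epsilon^0)=x^0$, where $\mathcal N^{x^0}\times\mathcal N^{\epsilon^0}\subset U\times V$ is an open neighborhood of $(x^0;\epsilon^0)$ in which the equilibrium points are exactly the points $(X^{\mathrm{loc}}(\epsilon);\epsilon)$, $\epsilon\in\mathcal N^{\epsilon^0}$; put $A^{\mathrm{loc}}(\epsilon)=A(X^{\mathrm{loc}}(\epsilon);\epsilon)$.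 By perturbed eigenvalues we mean real analytic functions $\lambda^{\pm}:\mathcal N_1^{\epsilon^0}\to\mathbb C$ on an open neighborhood $\mathcal N_1^{\epsilon^0}\subset\mathcal N^{\epsilon^0}$ of $\epsilon^0$ such that $\lambda^{\pm}(\epsilon^0)=\lambda_0^{\pm}$ and $\lambda^{\pm}(\epsilon)$ are simple isolated eigenvalues of $A^{\mathrm{loc}}(\epsilon)$ for all $\epsilon\in\mathcal N_1^{\epsilon^0}$; put $\mathfrak r(\epsilon)=\operatorname{Re}\lambda^+(\epsilon)$. The point $(x^0;\epsilon^0)$ is $\mathfrak r$-regular if $\nabla\mathfrak r(\epsilon^0)\ne0$. Proposition. (1) At every $\sigma(A)$-critical equilibrium point $(x^0;\epsilon^0)$ a local parametrization exists, and for every local parametrization perturbed eigenvalues exist. If, moreover, $A(x^0;\epsilon^0)$ is $\mathbb H$-sectorial, then for every local parametrization $X^{\mathrm{loc}}$: (i) $A^{\mathrm{loc}}(\epsilon)$ is $\mathbb H$-sectorial for all $\epsilon$ in some open neighborhood $\mathcal N_2^{\epsilon^0}\subset\mathcal N^{\epsilon^0}$ of $\epsilon^0$; (ii) for all perturbed eigenvalues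 $\lambda^\pm$ there is an open neighborhood $\mathcal N_3^{\epsilon^0}\subset\mathcal N_1^{\epsilon^0}$ of $\epsilon^0$ such that for all $\epsilon\in\mathcal N_3^{\epsilon^0}$ one has $\lambda^-(\epsilon)=\overline{\lambda^+(\epsilon)}$, and the equilibrium point $(X^{\mathrm{loc}}(\epsilon);\epsilon)$ is $\sigma(A)$-critical if and only if $\mathfrak r(\epsilon)=0$. (2) The set of all $\mathfrak r$-regular $\sigma(A)$-critical equilibrium points $(x;\epsilon)$ such that $A(x;\epsilon)$ is $\mathbb H$-sectorial is an analytic $(n-1)$-dimensional (embedded) submanifold of $\mathcal X\times\mathbb R^n$. -/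

import Mathlib

open Set

noncomputable section

set_option linter.unusedSectionVars false

namespace HopfSpec

/-! ### The complexification of a real normed space -/

/-- The complexification `X + iX` of a real vector space. -/
@[ext]
structure Complexification (X : Type*) where
  re : X
  im : X

namespace Complexification

/-- `x + iy` corresponds to the pair `(x, y)`. -/
def equivProd (X : Type*) : Complexification X ≃ X × X where
  toFun v := (v.re, v.im)
  invFun p := ⟨p.1, p.2⟩
  left_inv _ := rfl
  right_inv _ := rfl

section Normed

variable {X Z : Type*} [NormedAddCommGroup X] [NormedSpace ℝ X]
  [NormedAddCommGroup Z] [NormedSpace ℝ Z]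

instance : AddCommGroup (Complexification X) := (equivProd X).addCommGroup

@[simp] theorem re_zero : (0 : Complexification X).re = 0 := rfl
@[simp] theorem im_zero : (0 : Complexification X).im = 0 := rfl
@[simp] theorem re_add (v w : Complexification X) : (v + w).re = v.re + w.re := rfl
@[simp] theorem im_add (v w : Complexification X) : (v + w).im = v.im + w.im := rfl

/-- `(a + ib)(x + iy) = (ax - by) + i(ay + bx)`. -/
instance : SMul ℂ (Complexification X) :=
  ⟨fun c v => ⟨c.re • v.re - c.im • v.im, c.re • v.im + c.im • v.re⟩⟩

@[simp] theorem re_smul (c : ℂ) (v : Complexification X) :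
    (c • v).re = c.re • v.re - c.im • v.im := rfl
@[simp] theorem im_smul (c : ℂ) (v : Complexification X) :
    (c • v).im = c.re • v.im + c.im • v.re := rfl

instance : Module ℂ (Complexification X) where
  one_smul v := by ext <;> simp
  mul_smul c d v := by
    ext <;> simp only [re_smul, im_smul, Complex.mul_re, Complex.mul_im] <;> module
  smul_zero c := by ext <;> simp
  smul_add c v w := by
    ext <;> simp only [re_smul, im_smul, re_add, im_add] <;> module
  add_smul c d v := by
    ext <;> simp only [re_smul, im_smul, re_add, im_add, Complex.add_re, Complex.add_im] <;>
      module
  zero_smul v := by ext <;> simp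

/-- The real-linear map `z ↦ Re (z (x + iy))`, additively in `x + iy`. Its operator norm is
`sup_θ ‖cos θ • x - sin θ • y‖`. -/
def reMul : Complexification X →+ (ℂ →L[ℝ] X) where
  toFun v := Complex.reCLM.smulRight v.re - Complex.imCLM.smulRight v.im
  map_zero' := by ext <;> simp
  map_add' v w := by
    refine ContinuousLinearMap.ext fun z => ?_
    simp only [sub_apply, add_apply,
      ContinuousLinearMap.smulRight_apply, re_add, im_add, smul_add]
    abel

theorem reMul_apply (v : Complexification X) (z : ℂ) :
    reMul v z = z.re • v.re - z.im • v.im := by simp [reMul]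

theorem reMul_injective : Function.Injective (reMul : Complexification X →+ (ℂ →L[ℝ] X)) := by
  intro v w h
  have h1 := DFunLike.congr_fun h 1
  have h2 := DFunLike.congr_fun h Complex.I
  simp only [reMul_apply] at h1 h2
  ext
  · simpa using h1
  · simpa using h2

theorem reMul_smul (c : ℂ) (v : Complexification X) (z : ℂ) :
    reMul (c • v) z = reMul v (c * z) := by
  simp only [reMul_apply, re_smul, im_smul, Complex.mul_re, Complex.mul_im]
  module

/-- The norm `‖x + iy‖ = sup_θ ‖cos θ • x - sin θ • y‖`. -/
instance : NormedAddCommGroup (Complexification X) :=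
  NormedAddCommGroup.induced _ _ (reMul : Complexification X →+ (ℂ →L[ℝ] X)) reMul_injective

theorem norm_def (v : Complexification X) : ‖v‖ = ‖reMul v‖ := rfl

instance : NormedSpace ℂ (Complexification X) where
  norm_smul_le c v := by
    rw [norm_def, norm_def]
    refine ContinuousLinearMap.opNorm_le_bound _ (by positivity) fun z => ?_
    rw [reMul_smul]
    refine ((reMul v).le_opNorm _).trans (le_of_eq ?_)
    rw [norm_mul]; ring

instance [CompleteSpace X] : CompleteSpace (Complexification X) := by
  have hiso : Isometry (reMul : Complexification X →+ (ℂ →L[ℝ] X)) :=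
    AddMonoidHomClass.isometry_of_norm _ fun v => (norm_def v).symm
  have hsurj : Function.Surjective (reMul : Complexification X →+ (ℂ →L[ℝ] X)) := by
    intro f
    refine ⟨⟨f 1, -f Complex.I⟩, ?_⟩
    refine ContinuousLinearMap.ext fun z => ?_
    have hz : z = z.re • (1 : ℂ) + z.im • Complex.I := by
      apply Complex.ext <;> simp
    conv_rhs => rw [hz, map_add, map_smul, map_smul]
    simp [reMul_apply]
  exact (hiso.isUniformInducing.completeSpace_congr hsurj).2 inferInstance

/-- The complexification `x + iy ↦ T x + i T y` of a bounded real operator. -/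
def map (T : X →L[ℝ] Z) : Complexification X →L[ℂ] Complexification Z :=
  LinearMap.mkContinuous
    { toFun := fun v => ⟨T v.re, T v.im⟩
      map_add' := fun v w => by ext <;> simp
      map_smul' := fun c v => by ext <;> simp }
    ‖T‖ (fun v => by
      have h : reMul (⟨T v.re, T v.im⟩ : Complexification Z) = T.comp (reMul v) := by
        ext; simp [reMul_apply]
      change ‖reMul (⟨T v.re, T v.im⟩ : Complexification Z)‖ ≤ _
      rw [h]
      exact T.opNorm_comp_le _)

@[simp] theorem map_re (T : X →L[ℝ] Z) (v : Complexification X) : (map T v).re = T v.re := rfl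
@[simp] theorem map_im (T : X →L[ℝ] Z) (v : Complexification X) : (map T v).im = T v.im := rfl

theorem map_injective {T : X →L[ℝ] Z} (hT : Function.Injective T) :
    Function.Injective (map T) := by
  intro v w h
  ext
  · exact hT (congrArg re h)
  · exact hT (congrArg im h)

end Normed

end Complexification

/-! ### Spectral theory of unbounded operators -/

section Spectral

variable {Y : Type*} [NormedAddCommGroup Y] [NormedSpace ℂ Y]

/-- The bounded operator `R` is the inverse `(T - ζ I)⁻¹` of `T - ζ I : dom T → Y`. -/
def IsResolventAt (T : Y →ₗ.[ℂ] Y) (ζ : ℂ) (R : Y →L[ℂ] Y) : Prop :=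
  (∀ y : Y, ∃ u : T.domain, (u : Y) = R y ∧ T u - ζ • (u : Y) = y) ∧
    ∀ u : T.domain, R (T u - ζ • (u : Y)) = u

/-- The resolvent set of an unbounded operator. -/
def resolvSet (T : Y →ₗ.[ℂ] Y) : Set ℂ := {ζ | ∃ R : Y →L[ℂ] Y, IsResolventAt T ζ R}

/-- The spectrum of an unbounded operator. -/
def spec (T : Y →ₗ.[ℂ] Y) : Set ℂ := (resolvSet T)ᶜ

open Classical in
/-- The resolvent `(T - ζ I)⁻¹` for `ζ` in the resolvent set (and `0` elsewhere). -/
def resolv (T : Y →ₗ.[ℂ] Y) (ζ : ℂ) : Y →L[ℂ] Y :=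
  if h : ∃ R : Y →L[ℂ] Y, IsResolventAt T ζ R then h.choose else 0

/-- The integral `-(2πi)⁻¹ ∮ (T - z I)⁻¹ dz` over the circle of radius `r` around `ζ`; it is the
Riesz projection if `ζ` is the only point of the spectrum in the closed disc. -/
def rieszProj (T : Y →ₗ.[ℂ] Y) (ζ : ℂ) (r : ℝ) : Y →L[ℂ] Y :=
  -((2 * Real.pi * Complex.I : ℂ)⁻¹ • ∮ z in C(ζ, r), resolv T z)

/-- `ζ` is an eigenvalue of `T`. -/
def IsEigenvalue (T : Y →ₗ.[ℂ] Y) (ζ : ℂ) : Prop :=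
  ∃ u : T.domain, (u : Y) ≠ 0 ∧ T u = ζ • (u : Y)

/-- `ζ` is an isolated eigenvalue of `T` of algebraic multiplicity `1`. As usual, the algebraic
multiplicity of an isolated eigenvalue is the dimension of the range of its Riesz projection. -/
def IsSimpleIsolatedEigenvalue (T : Y →ₗ.[ℂ] Y) (ζ : ℂ) : Prop :=
  IsEigenvalue T ζ ∧ ∃ r : ℝ, 0 < r ∧ spec T ∩ Metric.closedBall ζ r = {ζ} ∧
    Module.finrank ℂ (LinearMap.range (rieszProj T ζ r).toLinearMap) = 1

/-- The open sector `|arg ζ| < φ`, `ζ ≠ 0`. -/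
def sector (φ : ℝ) : Set ℂ := {ζ | ζ ≠ 0 ∧ |ζ.arg| < φ}

/-- The class `ℍ(ω, 0)`. -/
def IsHSectorialZero (ω : ℝ) (T : Y →ₗ.[ℂ] Y) : Prop :=
  Dense (T.domain : Set Y) ∧ T.IsClosed ∧ sector (Real.pi / 2 + ω) ⊆ resolvSet T ∧
    ∀ ω' ∈ Ico 0 ω, ∃ M : ℝ, 0 < M ∧ ∀ ζ ∈ sector (Real.pi / 2 + ω'),
      ‖resolv T ζ‖ ≤ M / ‖ζ‖

/-- The class `ℍ`, i.e. the union over real `ζ₀` and `ω ∈ (0, π/2]` of the classes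
`ℍ(ω, ζ₀) = {T₀ + ζ₀ I : T₀ ∈ ℍ(ω, 0)}`. -/
def IsHSectorial (T : Y →ₗ.[ℂ] Y) : Prop :=
  ∃ (ζ₀ : ℝ) (ω : ℝ), ω ∈ Ioc 0 (Real.pi / 2) ∧
    ∃ T₀ : Y →ₗ.[ℂ] Y, IsHSectorialZero ω T₀ ∧
      T = ((ζ₀ : ℂ) • (LinearMap.id : Y →ₗ[ℂ] Y)) +ᵥ T₀

end Spectral

/-- A linear map `T : X → Z`, seen as an operator in `Z` whose domain is `X`, embedded
in `Z` by `j`. -/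
def asOperatorIn {X Z : Type*} [AddCommGroup X] [Module ℂ X] [AddCommGroup Z] [Module ℂ Z]
    (j : X →ₗ[ℂ] Z) (hj : Function.Injective j) (T : X →ₗ[ℂ] Z) : Z →ₗ.[ℂ] Z where
  domain := LinearMap.range j
  toFun := T ∘ₗ (LinearEquiv.ofInjective j hj).symm.toLinearMap

/-! ### Equilibria of `∂ₜ x = F(x; ε)` and their linearizations -/

section Equilibria

variable {X Z : Type*} [NormedAddCommGroup X] [NormedSpace ℝ X]
  [NormedAddCommGroup Z] [NormedSpace ℝ Z] {n : ℕ}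

/-- The operator `A(x; ε)`: the complexification of the derivative `D_x F(x; ε)`, as an operator in
the complexification of `Z` whose domain is the complexification of `X`. -/
def linearization (ι : X →L[ℝ] Z) (hι : Function.Injective ι)
    (F : X × EuclideanSpace ℝ (Fin n) → Z) (x : X) (ε : EuclideanSpace ℝ (Fin n)) :
    Complexification Z →ₗ.[ℂ] Complexification Z :=
  asOperatorIn (Complexification.map ι).toLinearMap (Complexification.map_injective hι)
    (Complexification.map (fderiv ℝ (fun y => F (y, ε)) x)).toLinearMap

/-- `(x; ε)` is a `σ(A)`-critical equilibrium point of `∂ₜ x = F(x; ε)` in `U × V`. -/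
def IsCriticalPoint (ι : X →L[ℝ] Z) (hι : Function.Injective ι) (U : Set X)
    (V : Set (EuclideanSpace ℝ (Fin n))) (F : X × EuclideanSpace ℝ (Fin n) → Z)
    (x : X) (ε : EuclideanSpace ℝ (Fin n)) : Prop :=
  x ∈ U ∧ ε ∈ V ∧ F (x, ε) = 0 ∧
    spec (linearization ι hι F x ε) ⊆ {ζ : ℂ | ζ.re ≤ 0} ∧
    ∃ l : ℂ, 0 < l.im ∧
      spec (linearization ι hι F x ε) ∩ {ζ : ℂ | ζ.re = 0} = {l, starRingEnd ℂ l} ∧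
      IsSimpleIsolatedEigenvalue (linearization ι hι F x ε) l ∧
      IsSimpleIsolatedEigenvalue (linearization ι hι F x ε) (starRingEnd ℂ l)

/-- `Xloc : Nε → Nx` is a real analytic parametrization, passing through `(x₀; ε₀)`, of all
equilibrium points in the neighborhood `Nx × Nε ⊆ U × V` of `(x₀; ε₀)`. -/
structure IsLocalParametrization (U : Set X) (V : Set (EuclideanSpace ℝ (Fin n)))
    (F : X × EuclideanSpace ℝ (Fin n) → Z) (x₀ : X) (ε₀ : EuclideanSpace ℝ (Fin n))
    (Nx : Set X) (Nε : Set (EuclideanSpace ℝ (Fin n)))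
    (Xloc : EuclideanSpace ℝ (Fin n) → X) : Prop where
  isOpen_Nx : IsOpen Nx
  isOpen_Nε : IsOpen Nε
  mem_Nx : x₀ ∈ Nx
  mem_Nε : ε₀ ∈ Nε
  Nx_subset : Nx ⊆ U
  Nε_subset : Nε ⊆ V
  analytic : AnalyticOnNhd ℝ Xloc Nε
  mapsTo : MapsTo Xloc Nε Nx
  base : Xloc ε₀ = x₀
  equilibria : ∀ x ∈ Nx, ∀ ε ∈ Nε, F (x, ε) = 0 ↔ x = Xloc ε

/-- `lp` and `lm` are the perturbed eigenvalues `λ⁺` and `λ⁻`: real analytic functions in an open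
neighborhood `N₁ ⊆ Nε` of `ε₀` whose values are simple isolated eigenvalues of
`A(Xloc(ε); ε)`, and whose values at `ε₀` form a conjugate pair of nonzero purely imaginary
numbers, that of `lp` in the upper half-plane. -/
structure IsPerturbedEigenvaluePair (ι : X →L[ℝ] Z) (hι : Function.Injective ι)
    (F : X × EuclideanSpace ℝ (Fin n) → Z) (ε₀ : EuclideanSpace ℝ (Fin n))
    (Nε : Set (EuclideanSpace ℝ (Fin n))) (Xloc : EuclideanSpace ℝ (Fin n) → X)
    (N₁ : Set (EuclideanSpace ℝ (Fin n))) (lp lm : EuclideanSpace ℝ (Fin n) → ℂ) : Prop where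
  isOpen : IsOpen N₁
  mem : ε₀ ∈ N₁
  subset : N₁ ⊆ Nε
  analytic_lp : AnalyticOnNhd ℝ lp N₁
  analytic_lm : AnalyticOnNhd ℝ lm N₁
  re_base : (lp ε₀).re = 0
  im_base : 0 < (lp ε₀).im
  conj_base : lm ε₀ = starRingEnd ℂ (lp ε₀)
  simple_lp : ∀ ε ∈ N₁, IsSimpleIsolatedEigenvalue (linearization ι hι F (Xloc ε) ε) (lp ε)
  simple_lm : ∀ ε ∈ N₁, IsSimpleIsolatedEigenvalue (linearization ι hι F (Xloc ε) ε) (lm ε)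

/-- `(x₀; ε₀)` is `𝔯`-regular: the gradient at `ε₀` of `𝔯(ε) = Re λ⁺(ε)` does not vanish. -/
def IsRRegular (ι : X →L[ℝ] Z) (hι : Function.Injective ι) (U : Set X)
    (V : Set (EuclideanSpace ℝ (Fin n))) (F : X × EuclideanSpace ℝ (Fin n) → Z)
    (x₀ : X) (ε₀ : EuclideanSpace ℝ (Fin n)) : Prop :=
  ∃ (Nx : Set X) (Nε : Set (EuclideanSpace ℝ (Fin n))) (Xloc : EuclideanSpace ℝ (Fin n) → X)
    (N₁ : Set (EuclideanSpace ℝ (Fin n))) (lp lm : EuclideanSpace ℝ (Fin n) → ℂ),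
    IsLocalParametrization U V F x₀ ε₀ Nx Nε Xloc ∧
    IsPerturbedEigenvaluePair ι hι F ε₀ Nε Xloc N₁ lp lm ∧
    gradient (fun ε => (lp ε).re) ε₀ ≠ 0

end Equilibria

/-- `M` is a real analytic `k`-dimensional (embedded) submanifold of the normed space `E`: near
each of its points, `M` is the homeomorphic image of an open subset of `ℝᵏ` under a real analytic
immersion. -/
def IsAnalyticSubmanifold {E : Type*} [NormedAddCommGroup E] [NormedSpace ℝ E] (k : ℕ)
    (M : Set E) : Prop :=
  ∀ p ∈ M, ∃ (W : Set E) (Ω : Set (EuclideanSpace ℝ (Fin k)))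
    (φ : EuclideanSpace ℝ (Fin k) → E),
    IsOpen W ∧ p ∈ W ∧ IsOpen Ω ∧ AnalyticOnNhd ℝ φ Ω ∧
    (∀ t ∈ Ω, Function.Injective (fderiv ℝ φ t)) ∧
    Topology.IsEmbedding (Ω.domRestrict φ) ∧ φ '' Ω = M ∩ W

end HopfSpec

end

open HopfSpec

noncomputable section

set_option linter.unusedSectionVars false

namespace HopfSpec

/-! ### Resolvents of unbounded operators -/

section Resolvent

variable {Y : Type*} [NormedAddCommGroup Y] [NormedSpace ℂ Y]

/-! The domain of `A(x; ε)` never changes, so the unbounded perturbation problem is one for bounded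
operators `T : E → G` with a fixed embedding `j : E → G`: `ζ` is in the spectrum exactly when the
pencil `T - ζ j` is not invertible, and `T` depends analytically on `(x; ε)`. At a critical point
`0` is not in the spectrum, so the implicit function theorem yields the local parametrization.

A Riesz projection of rank one makes a bordered (Grushin) operator invertible, and the spectrum
nearby is the zero set of its scalar Schur complement, analytic in `(T, ζ)`. At the eigenvalue its
`ζ`-derivative is `1`; the implicit function theorem gives an analytic eigenvalue
(`exists_analyticAt_eigenvalue`), and a residue computation shows that simple zeros are simple
eigenvalues.

A sectorial bound survives small perturbations with uniform constants (`SectorialBound.eventually`).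
Spectrum in the closed right half-plane is then confined to a fixed disc. Compactness excludes it
away from the two critical eigenvalues, so only `λ±` can occur there. They are conjugate because `A`
is real, hence criticality means `𝔯 = 0`. The critical set is locally the graph of `Xloc` over the
hypersurface `𝔯 = 0`, regular where the gradient of `𝔯` is nonzero. -/

theorem IsResolventAt.unique {T : Y →ₗ.[ℂ] Y} {ζ : ℂ} {R R' : Y →L[ℂ] Y}
    (h : IsResolventAt T ζ R) (h' : IsResolventAt T ζ R') : R = R' := by
  ext y
  obtain ⟨u, hu, hy⟩ := h.1 y
  rw [← hu, ← h'.2 u, hy]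

theorem IsResolventAt.resolv_eq {T : Y →ₗ.[ℂ] Y} {ζ : ℂ} {R : Y →L[ℂ] Y}
    (h : IsResolventAt T ζ R) : resolv T ζ = R := by
  have hex : ∃ R : Y →L[ℂ] Y, IsResolventAt T ζ R := ⟨R, h⟩
  rw [resolv, dif_pos hex]
  exact hex.choose_spec.unique h

theorem IsEigenvalue.mem_spec {T : Y →ₗ.[ℂ] Y} {ζ : ℂ} (h : IsEigenvalue T ζ) : ζ ∈ spec T := by
  rintro ⟨R, hR⟩
  obtain ⟨u, hu, he⟩ := h
  have := hR.2 u
  rw [he, sub_self, map_zero] at this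
  exact hu this.symm

end Resolvent

/-! ### Circle integrals and bounded operators -/

section CircleIntegral

theorem circleIntegral_clm_comm {E F : Type*} [NormedAddCommGroup E] [NormedSpace ℂ E]
    [CompleteSpace E] [NormedAddCommGroup F] [NormedSpace ℂ F] [CompleteSpace F]
    (L : E →L[ℂ] F) {f : ℂ → E} {c : ℂ} {r : ℝ} (hf : CircleIntegrable f c r) :
    (∮ z in C(c, r), L (f z)) = L (∮ z in C(c, r), f z) := by
  simp only [circleIntegral]
  rw [← ContinuousLinearMap.intervalIntegral_comp_comm L hf.out]
  simp

end CircleIntegral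

/-! ### Operator pencils and bordering at a simple eigenvalue -/

section Pencil

variable {E G : Type*} [NormedAddCommGroup E] [NormedSpace ℂ E]
  [NormedAddCommGroup G] [NormedSpace ℂ G]

/-- The operator pencil `T - ζ j`. -/
def pencil (j T : E →L[ℂ] G) (ζ : ℂ) : E →L[ℂ] G := T - ζ • j

theorem pencil_apply (j T : E →L[ℂ] G) (ζ : ℂ) (x : E) : pencil j T ζ x = T x - ζ • j x := rfl

theorem pencil_sub_pencil (j T : E →L[ℂ] G) (ζ ξ : ℂ) (x : E) :
    pencil j T ζ x = pencil j T ξ x + (ξ - ζ) • j x := by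
  simp only [pencil_apply]; module

theorem asOperatorIn_mk (j T : E →L[ℂ] G) (hj : Function.Injective j) (x : E)
    (hx : j x ∈ (asOperatorIn j.toLinearMap hj T.toLinearMap).domain) :
    asOperatorIn j.toLinearMap hj T.toLinearMap ⟨j x, hx⟩ = T x := by
  have : (LinearEquiv.ofInjective j.toLinearMap hj).symm ⟨j x, hx⟩ = x := by
    rw [LinearEquiv.symm_apply_eq]; rfl
  change T ((LinearEquiv.ofInjective j.toLinearMap hj).symm ⟨j x, hx⟩) = T x
  rw [this]

theorem mem_domain_asOperatorIn (j T : E →L[ℂ] G) (hj : Function.Injective j) (x : E) :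
    j x ∈ (asOperatorIn j.toLinearMap hj T.toLinearMap).domain := ⟨x, rfl⟩

theorem isResolventAt_asOperatorIn {j T : E →L[ℂ] G} (hj : Function.Injective j) {ζ : ℂ}
    (h : (pencil j T ζ).IsInvertible) :
    IsResolventAt (asOperatorIn j.toLinearMap hj T.toLinearMap) ζ
      (j ∘L (pencil j T ζ).inverse) := by
  refine ⟨fun y => ⟨⟨j ((pencil j T ζ).inverse y), mem_domain_asOperatorIn j T hj _⟩, rfl, ?_⟩, ?_⟩
  · rw [asOperatorIn_mk]
    exact h.self_apply_inverse y
  · rintro ⟨_, x, rfl⟩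
    have := asOperatorIn_mk j T hj x (mem_domain_asOperatorIn j T hj x)
    change j ((pencil j T ζ).inverse (asOperatorIn j.toLinearMap hj T.toLinearMap
      ⟨j x, mem_domain_asOperatorIn j T hj x⟩ - ζ • j x)) = j x
    rw [this, ← pencil_apply, h.inverse_apply_self]

theorem resolv_asOperatorIn {j T : E →L[ℂ] G} (hj : Function.Injective j) {ζ : ℂ}
    (h : (pencil j T ζ).IsInvertible) :
    resolv (asOperatorIn j.toLinearMap hj T.toLinearMap) ζ = j ∘L (pencil j T ζ).inverse :=
  (isResolventAt_asOperatorIn hj h).resolv_eq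

theorem isEigenvalue_asOperatorIn_iff {j T : E →L[ℂ] G} (hj : Function.Injective j) {ζ : ℂ} :
    IsEigenvalue (asOperatorIn j.toLinearMap hj T.toLinearMap) ζ ↔
      ∃ x, x ≠ 0 ∧ T x = ζ • j x := by
  constructor
  · rintro ⟨⟨_, x, rfl⟩, hx, h⟩
    refine ⟨x, fun h0 => hx (by simp [h0]), ?_⟩
    rw [← asOperatorIn_mk j T hj x (mem_domain_asOperatorIn j T hj x)]
    exact h
  · rintro ⟨x, hx, h⟩
    refine ⟨⟨j x, mem_domain_asOperatorIn j T hj x⟩, fun h0 => hx ?_, ?_⟩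
    · exact hj (h0.trans (map_zero j).symm)
    · rw [asOperatorIn_mk, h]

theorem isInvertible_of_bijective [CompleteSpace E] [CompleteSpace G] {f : E →L[ℂ] G}
    (hf : Function.Bijective f) : f.IsInvertible :=
  ⟨ContinuousLinearEquiv.ofBijective f (LinearMap.ker_eq_bot.2 hf.1)
    (LinearMap.range_eq_top.2 hf.2), ContinuousLinearEquiv.coe_ofBijective _ _ _⟩

variable [CompleteSpace E] [CompleteSpace G]

/-- A resolvent that is bounded only in `G` already makes the pencil bijective; the open mapping
theorem then bounds the inverse in the norm of `E`. This is where completeness enters. -/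
theorem mem_resolvSet_asOperatorIn_iff {j T : E →L[ℂ] G} (hj : Function.Injective j) {ζ : ℂ} :
    ζ ∈ resolvSet (asOperatorIn j.toLinearMap hj T.toLinearMap) ↔
      (pencil j T ζ).IsInvertible := by
  refine ⟨fun ⟨R, hR⟩ => isInvertible_of_bijective ⟨?_, ?_⟩,
    fun h => ⟨_, isResolventAt_asOperatorIn hj h⟩⟩
  · rw [injective_iff_map_eq_zero]
    intro x hx
    have := hR.2 ⟨j x, mem_domain_asOperatorIn j T hj x⟩
    rw [asOperatorIn_mk, ← pencil_apply, hx, map_zero] at this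
    exact hj (this.symm.trans (map_zero j).symm)
  · intro y
    obtain ⟨⟨_, x, rfl⟩, -, h⟩ := hR.1 y
    refine ⟨x, ?_⟩
    rw [pencil_apply, ← asOperatorIn_mk j T hj x (mem_domain_asOperatorIn j T hj x)]
    exact h

theorem mem_spec_asOperatorIn_iff {j T : E →L[ℂ] G} (hj : Function.Injective j) {ζ : ℂ} :
    ζ ∈ spec (asOperatorIn j.toLinearMap hj T.toLinearMap) ↔ ¬ (pencil j T ζ).IsInvertible :=
  (mem_resolvSet_asOperatorIn_iff hj).not

theorem continuous_pencil (j : E →L[ℂ] G) :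
    Continuous fun p : (E →L[ℂ] G) × ℂ => pencil j p.1 p.2 := by
  unfold pencil; fun_prop

theorem isOpen_setOf_isInvertible : IsOpen {f : E →L[ℂ] G | f.IsInvertible} := by
  exact ContinuousLinearEquiv.isOpen (𝕜 := ℂ) (E := E) (F := G)

theorem continuousAt_inverse_pencil {j T : E →L[ℂ] G} {ζ : ℂ} (h : (pencil j T ζ).IsInvertible) :
    ContinuousAt (fun z => (pencil j T z).inverse) ζ := by
  have h1 : ContinuousAt ContinuousLinearMap.inverse (pencil j T ζ) :=
    (h.contDiffAt_map_inverse (n := 0)).continuousAt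
  have h2 : ContinuousAt (fun z => pencil j T z) ζ := by unfold pencil; fun_prop
  exact ContinuousAt.comp (f := fun z => pencil j T z) h1 h2

/-- Both sides of the resolvent identity, multiplied by `z - w`, become the same difference of
resolvents. -/
theorem inverse_pencil_comm {j T : E →L[ℂ] G} {z w : ℂ} (hz : (pencil j T z).IsInvertible)
    (hw : (pencil j T w).IsInvertible) (y : G) :
    (pencil j T z).inverse (j ((pencil j T w).inverse y)) =
      (pencil j T w).inverse (j ((pencil j T z).inverse y)) := by
  rcases eq_or_ne z w with rfl | hne
  · rfl
  have key : ∀ {a b : ℂ}, (pencil j T a).IsInvertible → (pencil j T b).IsInvertible →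
      (a - b) • (pencil j T a).inverse (j ((pencil j T b).inverse y)) =
        (pencil j T a).inverse y - (pencil j T b).inverse y := by
    intro a b ha hb
    apply ha.injective
    rw [map_smul, ha.self_apply_inverse, map_sub, ha.self_apply_inverse,
      pencil_sub_pencil j T a b, hb.self_apply_inverse]
    module
  have h1 := key hz hw
  have h2 := key hw hz
  apply smul_right_injective E (sub_ne_zero.2 hne)
  simp only
  rw [h1, ← neg_sub w z, neg_smul, h2]
  abel

/-- The bordered operator `(x, c) ↦ (T x - ζ j x + c v, ℓ (j x))`. -/
def bordered (j T : E →L[ℂ] G) (v : G) (ℓ : G →L[ℂ] ℂ) (ζ : ℂ) : E × ℂ →L[ℂ] G × ℂ :=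
  (pencil j T ζ ∘L ContinuousLinearMap.fst ℂ E ℂ +
    (ContinuousLinearMap.snd ℂ E ℂ).smulRight v).prod (ℓ ∘L j ∘L ContinuousLinearMap.fst ℂ E ℂ)

theorem bordered_apply (j T : E →L[ℂ] G) (v : G) (ℓ : G →L[ℂ] ℂ) (ζ : ℂ) (p : E × ℂ) :
    bordered j T v ℓ ζ p = (pencil j T ζ p.1 + p.2 • v, ℓ (j p.1)) := by
  simp [bordered]

/-- At a simple isolated eigenvalue, bordering by the eigenvector and the spectral functional
makes the pencil invertible. -/
theorem exists_isInvertible_bordered {j T : E →L[ℂ] G} (hj : Function.Injective j) {ζ : ℂ}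
    (h : IsSimpleIsolatedEigenvalue (asOperatorIn j.toLinearMap hj T.toLinearMap) ζ) :
    ∃ (u : E) (ℓ : G →L[ℂ] ℂ), pencil j T ζ u = 0 ∧ ℓ (j u) = 1 ∧
      (bordered j T (j u) ℓ ζ).IsInvertible := by
  obtain ⟨hev, r, hr, hspec, hrank⟩ := h
  obtain ⟨u, hu0, hu⟩ := (isEigenvalue_asOperatorIn_iff hj).1 hev
  have hNu : pencil j T ζ u = 0 := by rw [pencil_apply, hu, sub_self]
  have hinv : ∀ z ∈ Metric.sphere ζ r, (pencil j T z).IsInvertible := by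
    intro z hz
    by_contra hcon
    have : z ∈ spec (asOperatorIn j.toLinearMap hj T.toLinearMap) ∩ Metric.closedBall ζ r :=
      ⟨(mem_spec_asOperatorIn_iff hj).2 hcon, Metric.sphere_subset_closedBall hz⟩
    rw [hspec, mem_singleton_iff] at this
    rw [this, Metric.mem_sphere, dist_self] at hz
    exact hr.ne hz
  have hne : ∀ z ∈ Metric.sphere ζ r, z - ζ ≠ 0 := by
    intro z hz h0
    rw [sub_eq_zero.1 h0, Metric.mem_sphere, dist_self] at hz
    exact hr.ne hz
  set I : ℂ → (G →L[ℂ] E) := fun z => (pencil j T z).inverse with hI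
  have hIc : ContinuousOn I (Metric.sphere ζ r) := fun z hz =>
    (continuousAt_inverse_pencil (hinv z hz)).continuousWithinAt
  have hII : CircleIntegrable I ζ r := hIc.circleIntegrable hr.le
  have hinvc : ContinuousOn (fun z : ℂ => (z - ζ)⁻¹) (Metric.sphere ζ r) :=
    ContinuousOn.inv₀ (by fun_prop) hne
  have hSI : CircleIntegrable (fun z => (z - ζ)⁻¹ • I z) ζ r :=
    (hinvc.smul hIc).circleIntegrable hr.le
  set κ : ℂ := 2 * Real.pi * Complex.I with hκ
  have hκ0 : κ ≠ 0 := by simp [hκ, Real.pi_ne_zero]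
  -- `j ∘ Q` is the Riesz projection, with `Q` recording its values in `E`; `S` is the constant
  -- Laurent coefficient of the inverse pencil at `ζ`, the reduced resolvent.
  set Q : G →L[ℂ] E := -(κ⁻¹ • ∮ z in C(ζ, r), I z) with hQ
  set S : G →L[ℂ] E := κ⁻¹ • ∮ z in C(ζ, r), (z - ζ)⁻¹ • I z with hS
  have hP : rieszProj (asOperatorIn j.toLinearMap hj T.toLinearMap) ζ r = j ∘L Q := by
    have h1 : (∮ z in C(ζ, r), resolv (asOperatorIn j.toLinearMap hj T.toLinearMap) z) =
        ∮ z in C(ζ, r), (ContinuousLinearMap.compL ℂ G E G j) (I z) :=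
      circleIntegral.integral_congr hr.le fun z hz => resolv_asOperatorIn hj (hinv z hz)
    rw [rieszProj, h1, circleIntegral_clm_comm _ hII, hQ]
    ext y
    simp [hκ]
  have happly : ∀ {f : ℂ → (G →L[ℂ] E)} (y : G), CircleIntegrable f ζ r →
      (∮ z in C(ζ, r), f z) y = ∮ z in C(ζ, r), f z y := fun y hf =>
    (circleIntegral_clm_comm (ContinuousLinearMap.apply ℂ E y) hf).symm
  have hIy : ∀ y, CircleIntegrable (fun z => I z y) ζ r := fun y =>
    (hIc.clm_apply continuousOn_const).circleIntegrable hr.le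
  have hSIy : ∀ y, CircleIntegrable (fun z => (z - ζ)⁻¹ • I z y) ζ r := fun y =>
    (hinvc.smul (hIc.clm_apply continuousOn_const)).circleIntegrable hr.le
  -- On the kernel the inverse pencil is `-(z - ζ)⁻¹`, so its residue is explicit.
  have hQker : ∀ x, pencil j T ζ x = 0 → Q (j x) = x := by
    intro x hx
    have h1 : ∀ z ∈ Metric.sphere ζ r, I z (j x) = -((z - ζ)⁻¹ • x) := by
      intro z hz
      apply (hinv z hz).injective
      rw [(hinv z hz).self_apply_inverse, map_neg, map_smul, pencil_sub_pencil j T z ζ, hx,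
        zero_add, ← neg_sub z ζ, neg_smul, smul_neg, neg_neg, inv_smul_smul₀ (hne z hz)]
    have h2 : (∮ z in C(ζ, r), I z (j x)) = -(κ • x) := by
      rw [circleIntegral.integral_congr hr.le h1]
      have h3 : (fun z : ℂ => -((z - ζ)⁻¹ • x)) = fun z => (z - ζ)⁻¹ • (-x) := by
        funext z; rw [smul_neg]
      rw [h3, circleIntegral.integral_smul_const, circleIntegral.integral_sub_center_inv _ hr.ne',
        smul_neg]
    rw [hQ, neg_apply, smul_apply, happly _ hII, h2,
      smul_neg, neg_neg, inv_smul_smul₀ hκ0]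
  have hju : j u ≠ 0 := fun h0 => hu0 (hj (h0.trans (map_zero j).symm))
  obtain ⟨f, hf⟩ : ∃ f : G →L[ℂ] ℂ, f (j u) = 1 := SeparatingDual.exists_eq_one hju
  -- The projection has rank one and fixes `j u`, so it must be `y ↦ ℓ y • j u`.
  set ℓ : G →L[ℂ] ℂ := f ∘L j ∘L Q with hℓ
  have hPy : ∀ y, j (Q y) = ℓ y • j u := by
    intro y
    rw [hP] at hrank
    have hmem : j u ∈ LinearMap.range (j ∘L Q).toLinearMap := ⟨j u, by
      change j (Q (j u)) = _
      rw [hQker u hNu]⟩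
    have := (finrank_eq_one_iff_of_nonzero' (⟨j u, hmem⟩ :
      LinearMap.range (j ∘L Q).toLinearMap) (fun h0 => hju (congrArg Subtype.val h0))).1 hrank ⟨j (Q y), ⟨y, rfl⟩⟩
    obtain ⟨c, hc⟩ := this
    have hc' : c • j u = j (Q y) := congrArg Subtype.val hc
    have : ℓ y = c := by
      change f (j (Q y)) = c
      rw [← hc', map_smul, hf, smul_eq_mul, mul_one]
    rw [this, hc']
  have hℓu : ℓ (j u) = 1 := by
    change f (j (Q (j u))) = 1
    rw [hQker u hNu, hf]
  have hQI : ∀ w ∈ Metric.sphere ζ r, ∀ y, Q (j (I w y)) = I w (j (Q y)) := by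
    intro w hw y
    rw [hQ, neg_apply, smul_apply, happly _ hII,
      neg_apply, smul_apply, happly _ hII, map_neg, map_neg,
      map_smul, map_smul,
      circleIntegral.integral_congr hr.le fun z hz => inverse_pencil_comm (hinv z hz) (hinv w hw) y]
    have := circleIntegral_clm_comm (I w ∘L j) (hIy y)
    rw [ContinuousLinearMap.comp_apply] at this
    rw [← this]
    rfl
  -- `Q` commutes with the resolvent at one point `w` of the circle. Comparing coefficients of `j u`
  -- gives `ℓ (pencil j T w x) = (ζ - w) * ℓ (j x)`, that is, `ℓ` annihilates the range of the
  -- pencil at `ζ`.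
  have hcomm : ∀ x, ℓ (pencil j T ζ x) = 0 := by
    intro x
    have hw : ζ + r ∈ Metric.sphere ζ r := by simp [abs_of_pos hr]
    set w := ζ + r
    have h1 := hQI w hw (pencil j T w x)
    have h2 : I w (pencil j T w x) = x := (hinv w hw).inverse_apply_self x
    rw [h2, hPy, map_smul] at h1
    have h3 : pencil j T w (Q (j x)) = ℓ (pencil j T w x) • j u := by
      rw [h1, map_smul, (hinv w hw).self_apply_inverse]
    have h4 : Q (j x) = ℓ (j x) • u := hj (by rw [hPy, map_smul])
    rw [h4, map_smul, pencil_sub_pencil j T w ζ u, hNu, zero_add, smul_smul] at h3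
    have h5 := smul_left_injective ℂ hju h3
    rw [pencil_sub_pencil j T ζ w, map_add, map_smul, ← h5, smul_eq_mul]
    ring
  -- Multiplying the integrand of `S` by the pencil at `ζ` leaves `(z - ζ)⁻¹ y` plus the resolvent;
  -- their integrals give the identity minus the Riesz projection.
  have hNS : ∀ y, pencil j T ζ (S y) = y - ℓ y • j u := by
    intro y
    have h1 : S y = κ⁻¹ • ∮ z in C(ζ, r), (z - ζ)⁻¹ • I z y := by
      rw [hS, smul_apply, happly _ hSI]; rfl
    have h2 : ∀ z ∈ Metric.sphere ζ r, pencil j T ζ ((z - ζ)⁻¹ • I z y) =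
        (z - ζ)⁻¹ • y + j (I z y) := by
      intro z hz
      rw [map_smul, pencil_sub_pencil j T ζ z, (hinv z hz).self_apply_inverse, smul_add,
        inv_smul_smul₀ (hne z hz)]
    have h3 : CircleIntegrable (fun z : ℂ => (z - ζ)⁻¹ • y) ζ r :=
      (hinvc.smul continuousOn_const).circleIntegrable hr.le
    have h4 : CircleIntegrable (fun z : ℂ => j (I z y)) ζ r :=
      (continuousOn_const.clm_apply (hIc.clm_apply continuousOn_const)).circleIntegrable hr.le
    have h5 : j (Q y) = -(κ⁻¹ • j (∮ z in C(ζ, r), I z y)) := by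
      rw [hQ, neg_apply, smul_apply, happly _ hII, map_neg,
        map_smul]
    rw [h1, map_smul, ← circleIntegral_clm_comm _ (hSIy y), circleIntegral.integral_congr hr.le h2,
      circleIntegral.integral_add h3 h4, circleIntegral.integral_smul_const,
      circleIntegral.integral_sub_center_inv _ hr.ne', circleIntegral_clm_comm _ (hIy y), smul_add,
      inv_smul_smul₀ hκ0, ← hPy, h5]
    abel
  refine ⟨u, ℓ, hNu, hℓu, isInvertible_of_bijective ⟨?_, ?_⟩⟩
  · rw [injective_iff_map_eq_zero]
    rintro ⟨x, c⟩ hx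
    rw [bordered_apply, Prod.mk_eq_zero] at hx
    obtain ⟨h1, h2⟩ := hx
    simp only at h1 h2
    have hc : c = 0 := by
      have := congrArg ℓ h1
      simpa [hcomm, hℓu] using this
    rw [hc, zero_smul, add_zero] at h1
    have := hPy (j x)
    rw [h2, zero_smul, hQker x h1] at this
    rw [hc, hj (this.trans (map_zero j).symm)]
    rfl
  · rintro ⟨y, b⟩
    -- `S y` misses `y` by `ℓ y • j u`, which the second entry restores; the multiple of `u`,
    -- invisible to the pencil, corrects the value of `ℓ`.
    refine ⟨(S y + (b - ℓ (j (S y))) • u, ℓ y), ?_⟩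
    rw [bordered_apply]
    ext
    · simp [hNS, hNu]
    · simp [hℓu]

end Pencil

/-! ### Analytic perturbation of simple eigenvalues through the Schur complement -/

section Grushin

open Filter Topology
open scoped ContDiff

variable {E G : Type*} [NormedAddCommGroup E] [NormedSpace ℂ E] [CompleteSpace E]
  [NormedAddCommGroup G] [NormedSpace ℂ G] [CompleteSpace G]

theorem contDiff_bordered (j : E →L[ℂ] G) (v : G) (ℓ : G →L[ℂ] ℂ) :
    ContDiff ℂ ω fun p : (E →L[ℂ] G) × ℂ => bordered j p.1 v ℓ p.2 := by
  have h : (fun p : (E →L[ℂ] G) × ℂ => bordered j p.1 v ℓ p.2) = fun p =>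
      ContinuousLinearMap.inl ℂ G ℂ ∘L (p.1 - p.2 • j) ∘L ContinuousLinearMap.fst ℂ E ℂ +
        bordered j 0 v ℓ 0 := by
    funext p
    ext x <;> simp [bordered, pencil]
  rw [h]
  exact (contDiff_const.clm_comp ((contDiff_fst.sub (contDiff_snd.smul contDiff_const)).clm_comp
    contDiff_const)).add contDiff_const

theorem contDiffAt_inverse_bordered {j T : E →L[ℂ] G} {v : G} {ℓ : G →L[ℂ] ℂ} {ζ : ℂ}
    (h : (bordered j T v ℓ ζ).IsInvertible) :
    ContDiffAt ℂ ω (fun p : (E →L[ℂ] G) × ℂ => (bordered j p.1 v ℓ p.2).inverse) (T, ζ) :=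
  ContDiffAt.comp (T, ζ) (f := fun p : (E →L[ℂ] G) × ℂ => bordered j p.1 v ℓ p.2)
    h.contDiffAt_map_inverse (contDiff_bordered j v ℓ).contDiffAt

theorem bordered_inverse_fst {j T : E →L[ℂ] G} {v : G} {ℓ : G →L[ℂ] ℂ} {ζ : ℂ}
    (h : (bordered j T v ℓ ζ).IsInvertible) (q : G × ℂ) :
    pencil j T ζ ((bordered j T v ℓ ζ).inverse q).1 =
      q.1 - ((bordered j T v ℓ ζ).inverse q).2 • v := by
  have := h.self_apply_inverse q
  rw [bordered_apply] at this
  exact eq_sub_of_add_eq (congrArg Prod.fst this)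

theorem bordered_inverse_snd {j T : E →L[ℂ] G} {v : G} {ℓ : G →L[ℂ] ℂ} {ζ : ℂ}
    (h : (bordered j T v ℓ ζ).IsInvertible) (q : G × ℂ) :
    ℓ (j ((bordered j T v ℓ ζ).inverse q).1) = q.2 := by
  have := h.self_apply_inverse q
  rw [bordered_apply] at this
  exact congrArg Prod.snd this

theorem bordered_inverse_fst_ne_zero {j T : E →L[ℂ] G} {v : G} {ℓ : G →L[ℂ] ℂ} {ζ : ℂ}
    (h : (bordered j T v ℓ ζ).IsInvertible) : ((bordered j T v ℓ ζ).inverse (0, 1)).1 ≠ 0 := by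
  intro h0
  have := bordered_inverse_snd h (0, 1)
  rw [h0] at this
  simp at this

/-- The Schur complement of a bordered operator detects invertibility of the pencil. -/
theorem isInvertible_pencil_iff {j T : E →L[ℂ] G} {v : G} {ℓ : G →L[ℂ] ℂ} {ζ : ℂ}
    (h : (bordered j T v ℓ ζ).IsInvertible) :
    (pencil j T ζ).IsInvertible ↔ ((bordered j T v ℓ ζ).inverse (0, 1)).2 ≠ 0 := by
  set s := (bordered j T v ℓ ζ).inverse (0, 1) with hs
  constructor
  · intro hN h0
    have h1 := bordered_inverse_fst h (0, 1)
    rw [← hs, h0, zero_smul, sub_zero] at h1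
    exact bordered_inverse_fst_ne_zero h (hN.injective (h1.trans (map_zero _).symm))
  · intro h0
    refine isInvertible_of_bijective ⟨?_, fun y => ?_⟩
    · rw [injective_iff_map_eq_zero]
      intro x hx
      have h1 : bordered j T v ℓ ζ (x, 0) = ℓ (j x) • (0, 1) := by
        rw [bordered_apply]; ext <;> simp [hx]
      have h2 : (x, (0 : ℂ)) = ℓ (j x) • s := by
        rw [hs, ← map_smul, ← h1, h.inverse_apply_self]
      have h3 : ℓ (j x) = 0 := by
        have := congrArg Prod.snd h2
        simpa [h0] using this
      rw [h3, zero_smul] at h2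
      exact congrArg Prod.fst h2
    · set t := (bordered j T v ℓ ζ).inverse (y, 0) with ht
      refine ⟨t.1 - (s.2⁻¹ * t.2) • s.1, ?_⟩
      rw [map_sub, map_smul, hs, ht, bordered_inverse_fst h, bordered_inverse_fst h, ← hs, ← ht]
      simp [smul_smul, h0, mul_assoc, mul_comm t.2]

/-- The block formula `E₀ - E₊ φ⁻¹ E₋` for the inverse: only the scalar `φ⁻¹` can be singular, which
reduces poles of the resolvent to zeros of a scalar function. -/
theorem pencil_inverse_eq {j T : E →L[ℂ] G} {v : G} {ℓ : G →L[ℂ] ℂ} {ζ : ℂ}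
    (h : (bordered j T v ℓ ζ).IsInvertible) (h0 : ((bordered j T v ℓ ζ).inverse (0, 1)).2 ≠ 0)
    (y : G) :
    (pencil j T ζ).inverse y = ((bordered j T v ℓ ζ).inverse (y, 0)).1 -
      (((bordered j T v ℓ ζ).inverse (0, 1)).2⁻¹ * ((bordered j T v ℓ ζ).inverse (y, 0)).2) •
        ((bordered j T v ℓ ζ).inverse (0, 1)).1 := by
  have hN := (isInvertible_pencil_iff h).2 h0
  apply hN.injective
  rw [hN.self_apply_inverse, map_sub, map_smul, bordered_inverse_fst h, bordered_inverse_fst h]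
  set s := (bordered j T v ℓ ζ).inverse (0, 1)
  set t := (bordered j T v ℓ ζ).inverse (y, 0)
  have : s.2⁻¹ * t.2 * s.2 = t.2 := by field_simp
  simp [smul_smul, this]

/-- A simple zero of the Schur complement is a simple isolated eigenvalue. -/
theorem isSimpleIsolatedEigenvalue_of_schur {j T : E →L[ℂ] G} (hj : Function.Injective j) {v : G}
    {ℓ : G →L[ℂ] ℂ} {Ω : Set ℂ} (hΩ : IsOpen Ω) {ξ : ℂ} (hξ : ξ ∈ Ω)
    (hB : ∀ ζ ∈ Ω, (bordered j T v ℓ ζ).IsInvertible)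
    (hφ : ∀ ζ ∈ Ω, ((bordered j T v ℓ ζ).inverse (0, 1)).2 = 0 ↔ ζ = ξ)
    (hφ' : deriv (fun ζ => ((bordered j T v ℓ ζ).inverse (0, 1)).2) ξ ≠ 0) :
    IsSimpleIsolatedEigenvalue (asOperatorIn j.toLinearMap hj T.toLinearMap) ξ := by
  set D : ℂ → (G × ℂ →L[ℂ] E × ℂ) := fun ζ => (bordered j T v ℓ ζ).inverse with hD
  have hDd : DifferentiableOn ℂ D Ω := by
    intro z hz
    have h1 : DifferentiableAt ℂ
        (fun p : (E →L[ℂ] G) × ℂ => (bordered j p.1 v ℓ p.2).inverse) (T, z) :=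
      (contDiffAt_inverse_bordered (hB z hz)).differentiableAt (by simp)
    have h2 : DifferentiableAt ℂ (fun z : ℂ => (T, z)) z := by fun_prop
    exact (h1.comp z h2).differentiableWithinAt
  set φ : ℂ → ℂ := fun ζ => (D ζ (0, 1)).2 with hφdef
  have hφd : DifferentiableOn ℂ φ Ω :=
    (hDd.clm_apply (differentiableOn_const _)).snd
  have hφξ : φ ξ = 0 := (hφ ξ hξ).2 rfl
  obtain ⟨r, hr, hrΩ⟩ : ∃ r > 0, Metric.closedBall ξ r ⊆ Ω :=
    Metric.nhds_basis_closedBall.mem_iff.1 (hΩ.mem_nhds hξ)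
  refine ⟨(isEigenvalue_asOperatorIn_iff hj).2 ⟨(D ξ (0, 1)).1,
    bordered_inverse_fst_ne_zero (hB ξ hξ), ?_⟩, r, hr, ?_, ?_⟩
  · have := bordered_inverse_fst (hB ξ hξ) (0, 1)
    rw [(hφ ξ hξ).2 rfl, zero_smul, sub_zero, pencil_apply, sub_eq_zero] at this
    exact this
  · ext z
    constructor
    · rintro ⟨hz, hzr⟩
      by_contra hne
      rw [mem_spec_asOperatorIn_iff, isInvertible_pencil_iff (hB z (hrΩ hzr))] at hz
      exact hz fun h => hne ((hφ z (hrΩ hzr)).1 h)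
    · rintro rfl
      refine ⟨?_, Metric.mem_closedBall_self hr.le⟩
      rw [mem_spec_asOperatorIn_iff, isInvertible_pencil_iff (hB z hξ)]
      exact fun h => h hφξ
  -- The simple zero is factored out: `φ z = (z - ξ) * g z` with `g` holomorphic and zero-free on
  -- `Ω`.
  · set g : ℂ → ℂ := dslope φ ξ with hg
    have hgd : DifferentiableOn ℂ g Ω :=
      (Complex.differentiableOn_dslope (hΩ.mem_nhds hξ)).2 hφd
    have hgφ : ∀ z, φ z = (z - ξ) * g z := by
      intro z
      have := sub_smul_dslope φ ξ z
      rw [hφξ, sub_zero, smul_eq_mul] at this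
      exact this.symm
    have hgξ : g ξ = deriv φ ξ := dslope_same φ ξ
    have hg0 : ∀ z ∈ Ω, g z ≠ 0 := by
      intro z hz h0
      rcases eq_or_ne z ξ with rfl | hne
      · exact hφ' (hgξ ▸ h0)
      · exact hne ((hφ z hz).1 (by change φ z = 0; rw [hgφ, h0, mul_zero]))
    -- With the blocks of the bordered inverse the resolvent becomes `E0 z - (z - ξ)⁻¹ • K z`, both
    -- terms built from holomorphic functions. Cauchy's formula identifies the Riesz projection as
    -- `K ξ`, of rank at most one.
    set Em : ℂ → (G →L[ℂ] ℂ) := fun z =>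
      ContinuousLinearMap.snd ℂ E ℂ ∘L D z ∘L ContinuousLinearMap.inl ℂ G ℂ with hEm
    set Ep : ℂ → G := fun z => j (D z (0, 1)).1 with hEp
    set E0 : ℂ → (G →L[ℂ] G) := fun z =>
      j ∘L ContinuousLinearMap.fst ℂ E ℂ ∘L D z ∘L ContinuousLinearMap.inl ℂ G ℂ with hE0
    set K : ℂ → (G →L[ℂ] G) := fun z => (g z)⁻¹ • (Em z).smulRight (Ep z) with hK
    have hE0d : DifferentiableOn ℂ E0 Ω :=
      (differentiableOn_const _).clm_comp ((differentiableOn_const _).clm_comp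
        (hDd.clm_comp (differentiableOn_const _)))
    have hEmd : DifferentiableOn ℂ Em Ω :=
      (differentiableOn_const _).clm_comp (hDd.clm_comp (differentiableOn_const _))
    have hEpd : DifferentiableOn ℂ Ep Ω :=
      (differentiableOn_const _).clm_apply (hDd.clm_apply (differentiableOn_const _)).fst
    have hKd : DifferentiableOn ℂ K Ω := by
      refine (hgd.inv hg0).smul ?_
      intro z hz
      have := ((ContinuousLinearMap.smulRightL ℂ G G).isBoundedBilinearMap).differentiableAt
        (Em z, Ep z)
      exact this.comp_differentiableWithinAt z ((hEmd z hz).prodMk (hEpd z hz))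
    have hres : ∀ z ∈ Metric.sphere ξ r,
        resolv (asOperatorIn j.toLinearMap hj T.toLinearMap) z = E0 z - (z - ξ)⁻¹ • K z := by
      intro z hz
      have hzΩ := hrΩ (Metric.sphere_subset_closedBall hz)
      have hne : z ≠ ξ := by
        rintro rfl
        rw [Metric.mem_sphere, dist_self] at hz
        exact hr.ne hz
      have h0 : φ z ≠ 0 := fun h => hne ((hφ z hzΩ).1 h)
      rw [resolv_asOperatorIn hj ((isInvertible_pencil_iff (hB z hzΩ)).2 h0)]
      ext y
      rw [ContinuousLinearMap.comp_apply, pencil_inverse_eq (hB z hzΩ) h0, map_sub, map_smul]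
      change _ - ((φ z)⁻¹ * _) • _ = _
      rw [hgφ]
      simp [hE0, hK, hEm, hEp, hD, smul_smul, mul_comm]
    have hE0i : CircleIntegrable E0 ξ r :=
      (hE0d.continuousOn.mono (Metric.sphere_subset_closedBall.trans hrΩ)).circleIntegrable hr.le
    have hKi : CircleIntegrable (fun z => (z - ξ)⁻¹ • K z) ξ r := by
      have hsub : ContinuousOn (fun z : ℂ => z - ξ) (Metric.sphere ξ r) := by fun_prop
      refine ContinuousOn.circleIntegrable hr.le ((hsub.inv₀ ?_).smul
        (hKd.continuousOn.mono (Metric.sphere_subset_closedBall.trans hrΩ)))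
      intro z hz h0
      rw [sub_eq_zero.1 h0, Metric.mem_sphere, dist_self] at hz
      exact hr.ne hz
    have hriesz : rieszProj (asOperatorIn j.toLinearMap hj T.toLinearMap) ξ r = K ξ := by
      rw [rieszProj, circleIntegral.integral_congr hr.le hres, circleIntegral.integral_sub hE0i hKi,
        DiffContOnCl.circleIntegral_eq_zero hr.le
          ((hE0d.mono (Metric.closure_ball_subset_closedBall.trans hrΩ)).diffContOnCl),
        (hKd.mono hrΩ).circleIntegral_sub_inv_smul (Metric.mem_ball_self hr), zero_sub, smul_neg,
        neg_neg, inv_smul_smul₀ (by simp [Real.pi_ne_zero])]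
    have hEpξ : Ep ξ ≠ 0 := fun h =>
      bordered_inverse_fst_ne_zero (hB ξ hξ) (hj (h.trans (map_zero j).symm))
    -- As `φ ξ = 0`, a vanishing `Em ξ` would force the second component of the bordered inverse to
    -- be zero, contradicting surjectivity.
    obtain ⟨y, hy⟩ : ∃ y, Em ξ y ≠ 0 := by
      by_contra! hcon
      obtain ⟨q, hq⟩ := (hB ξ hξ).inverse.surjective (0, 1)
      have h1 : q = (q.1, 0) + q.2 • (0, 1) := by ext <;> simp
      have h2 : (D ξ q).2 = Em ξ q.1 + q.2 * φ ξ := by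
        conv_lhs => rw [h1, map_add, map_smul]
        rfl
      rw [hcon, hφξ, mul_zero, add_zero] at h2
      exact one_ne_zero ((congrArg Prod.snd hq).symm.trans h2)
    have hrange : LinearMap.range (K ξ).toLinearMap = ℂ ∙ Ep ξ := by
      ext w
      rw [Submodule.mem_span_singleton]
      constructor
      · rintro ⟨x, rfl⟩
        exact ⟨(g ξ)⁻¹ * Em ξ x, by simp [hK, smul_smul]⟩
      · rintro ⟨c, rfl⟩
        refine ⟨(c * g ξ * (Em ξ y)⁻¹) • y, ?_⟩
        have := hg0 ξ hξ
        simp only [hK, ContinuousLinearMap.coe_coe, map_smul, smul_apply,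
          ContinuousLinearMap.smulRight_apply, smul_smul]
        congr 1
        field_simp
    rw [hriesz, hrange, finrank_span_singleton hEpξ]

/-- Simple isolated eigenvalues depend analytically on the operator, and no other spectrum
appears nearby. -/
theorem exists_analyticAt_eigenvalue {j T₀ : E →L[ℂ] G} (hj : Function.Injective j) {ζ₀ : ℂ}
    (h : IsSimpleIsolatedEigenvalue (asOperatorIn j.toLinearMap hj T₀.toLinearMap) ζ₀) :
    ∃ (Λ : (E →L[ℂ] G) → ℂ) (δ : ℝ), 0 < δ ∧ AnalyticAt ℂ Λ T₀ ∧ Λ T₀ = ζ₀ ∧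
      ∀ᶠ T in 𝓝 T₀,
        IsSimpleIsolatedEigenvalue (asOperatorIn j.toLinearMap hj T.toLinearMap) (Λ T) ∧
        ∀ ζ ∈ Metric.ball ζ₀ δ,
          ζ ∈ spec (asOperatorIn j.toLinearMap hj T.toLinearMap) ↔ ζ = Λ T := by
  obtain ⟨u, ℓ, hu, hℓ, hB⟩ := exists_isInvertible_bordered hj h
  set v := j u
  set φ : (E →L[ℂ] G) × ℂ → ℂ := fun p => ((bordered j p.1 v ℓ p.2).inverse (0, 1)).2 with hφ
  have hφc : ∀ p : (E →L[ℂ] G) × ℂ, (bordered j p.1 v ℓ p.2).IsInvertible →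
      ContDiffAt ℂ ω φ p := fun p hp =>
    ((contDiffAt_inverse_bordered hp).clm_apply contDiffAt_const).snd
  have hBopen : IsOpen {p : (E →L[ℂ] G) × ℂ | (bordered j p.1 v ℓ p.2).IsInvertible} :=
    isOpen_setOf_isInvertible.preimage (contDiff_bordered j v ℓ).continuous
  have hBev : ∀ᶠ p in 𝓝 (T₀, ζ₀), (bordered j p.1 v ℓ p.2).IsInvertible := hBopen.mem_nhds hB
  -- Bordering by the eigenvector itself makes the Schur complement of `T₀` exactly `z - ζ₀`, so the
  -- partial derivative needed for the implicit function theorem is `1`.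
  have hφT₀ : ∀ z, (bordered j T₀ v ℓ z).IsInvertible → φ (T₀, z) = z - ζ₀ := by
    intro z hz
    have h1 : bordered j T₀ v ℓ z (u, z - ζ₀) = (0, 1) := by
      rw [bordered_apply, pencil_sub_pencil j T₀ z ζ₀, hu, hℓ]
      ext
      · simp only [v]; module
      · rfl
    simp only [hφ]
    rw [← h1, hz.inverse_apply_self]
  have hφ0 : φ (T₀, ζ₀) = 0 := by rw [hφT₀ _ hB, sub_self]
  have hcd := hφc (T₀, ζ₀) hB
  have hpartial : ∀ p : (E →L[ℂ] G) × ℂ, (bordered j p.1 v ℓ p.2).IsInvertible →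
      HasDerivAt (fun z => φ (p.1, z)) (fderiv ℂ φ p (0, 1)) p.2 := by
    intro p hp
    have h1 : HasFDerivAt φ (fderiv ℂ φ p) (p.1, p.2) :=
      ((hφc p hp).differentiableAt (by simp)).hasFDerivAt
    have h2 : HasDerivAt (fun z : ℂ => (p.1, z)) ((0 : E →L[ℂ] G), (1 : ℂ)) p.2 :=
      (hasDerivAt_const _ _).prodMk (hasDerivAt_id _)
    exact h1.comp_hasDerivAt p.2 h2
  have hd1 : fderiv ℂ φ (T₀, ζ₀) (0, 1) = 1 := by
    have h1 : HasDerivAt (fun z => φ (T₀, z)) 1 ζ₀ := by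
      refine ((hasDerivAt_id ζ₀).sub_const ζ₀).congr_of_eventuallyEq ?_
      have : ∀ᶠ z in 𝓝 ζ₀, (bordered j T₀ v ℓ z).IsInvertible :=
        (Continuous.tendsto (f := fun z : ℂ => (T₀, z)) (by fun_prop) ζ₀).eventually hBev
      filter_upwards [this] with z hz using hφT₀ z hz
    exact (hpartial (T₀, ζ₀) hB).unique h1
  have hinv : (fderiv ℂ φ (T₀, ζ₀) ∘L .inr ℂ (E →L[ℂ] G) ℂ).IsInvertible := by
    refine ⟨ContinuousLinearEquiv.refl ℂ ℂ, ?_⟩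
    ext
    simp [hd1]
  set Λ := hcd.implicitFunction (by simp) hinv
  have hΛan : AnalyticAt ℂ Λ T₀ := (hcd.contDiffAt_implicitFunction (by simp) hinv).analyticAt
  have hΛ0 : Λ T₀ = ζ₀ := hcd.implicitFunction_apply_self (by simp) hinv
  have hΛiff : ∀ᶠ p in 𝓝 (T₀, ζ₀), φ p = φ (T₀, ζ₀) ↔ Λ p.1 = p.2 :=
    hcd.eventually_apply_eq_iff_implicitFunction (by simp) hinv
  -- The zero stays simple for nearby `T`, hence so does the eigenvalue.
  have hder : ∀ᶠ p in 𝓝 (T₀, ζ₀), fderiv ℂ φ p (0, 1) ≠ 0 := by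
    have : ContinuousAt (fun p => fderiv ℂ φ p (0, 1)) (T₀, ζ₀) :=
      ((hcd.fderiv_right (m := 0) (by simp)).continuousAt).clm_apply continuousAt_const
    refine this.eventually_ne ?_
    rw [hd1]; exact one_ne_zero
  -- A product neighborhood makes the radius `δ` independent of `T`.
  have hall := hBev.and (hΛiff.and hder)
  rw [nhds_prod_eq, eventually_prod_iff] at hall
  obtain ⟨pa, hpa, pb, hpb, hab⟩ := hall
  obtain ⟨δ, hδ, hδb⟩ := Metric.eventually_nhds_iff_ball.1 hpb
  refine ⟨Λ, δ, hδ, hΛan, hΛ0, ?_⟩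
  have hΛball : ∀ᶠ T in 𝓝 T₀, Λ T ∈ Metric.ball ζ₀ δ :=
    hΛan.continuousAt.eventually_mem (by rw [hΛ0]; exact Metric.ball_mem_nhds _ hδ)
  filter_upwards [hpa, hΛball] with T hT hTb
  have hBT : ∀ z ∈ Metric.ball ζ₀ δ, (bordered j T v ℓ z).IsInvertible := fun z hz =>
    (hab hT (hδb z hz)).1
  have hφT : ∀ z ∈ Metric.ball ζ₀ δ,
      ((bordered j T v ℓ z).inverse (0, 1)).2 = 0 ↔ z = Λ T := by
    intro z hz
    have := (hab hT (hδb z hz)).2.1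
    rw [hφ0] at this
    rw [eq_comm (a := z)]
    exact this
  refine ⟨isSimpleIsolatedEigenvalue_of_schur hj Metric.isOpen_ball hTb hBT hφT ?_, ?_⟩
  · have h1 := (hpartial (T, Λ T) (hBT _ hTb)).deriv
    change deriv (fun z => φ (T, z)) (Λ T) ≠ 0
    rw [h1]
    exact (hab hT (hδb _ hTb)).2.2
  · intro z hz
    rw [mem_spec_asOperatorIn_iff, isInvertible_pencil_iff (hBT z hz), not_not, hφT z hz]

end Grushin

/-! ### Plane geometry of sectors -/

section Sector

/-- Cosine decreases on `[0, π]` and `cos (π/2 + ω) = -sin ω`, so the condition on the argument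
becomes one on the real part. -/
theorem mem_sector_iff {ω : ℝ} (h0 : 0 ≤ ω) (h1 : ω ≤ Real.pi / 2) {ζ : ℂ} :
    ζ ∈ sector (Real.pi / 2 + ω) ↔ ζ ≠ 0 ∧ -Real.sin ω * ‖ζ‖ < ζ.re := by
  refine and_congr_right fun hζ => ?_
  have hn : 0 < ‖ζ‖ := norm_pos_iff.2 hζ
  have hre : ζ.re = ‖ζ‖ * Real.cos |ζ.arg| := by
    rw [Real.cos_abs, Complex.norm_mul_cos_arg]
  have hsin : -Real.sin ω = Real.cos (Real.pi / 2 + ω) := by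
    rw [add_comm, Real.cos_add_pi_div_two]
  rw [hre, hsin, mul_comm, mul_lt_mul_iff_right₀ hn, Real.strictAntiOn_cos.lt_iff_gt]
  · exact ⟨by linarith [Real.pi_pos], by linarith⟩
  · exact ⟨abs_nonneg _, Complex.abs_arg_le_pi ζ⟩

/-- Translating a sector to the right moves it away from the origin. -/
theorem norm_mul_le_norm_add {s t : ℝ} (hs0 : 0 ≤ s) (hs1 : s < 1) (ht : 0 ≤ t) {ζ : ℂ}
    (hre : -s * ‖ζ‖ < ζ.re) :
    √(1 - s ^ 2) * ‖ζ‖ ≤ ‖(t : ℂ) + ζ‖ ∧ √(1 - s ^ 2) * t ≤ ‖(t : ℂ) + ζ‖ ∧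
      -s * ‖(t : ℂ) + ζ‖ < ((t : ℂ) + ζ).re := by
  have hs2 : 0 ≤ 1 - s ^ 2 := by nlinarith
  have hsq : ‖(t : ℂ) + ζ‖ ^ 2 = ‖ζ‖ ^ 2 + 2 * t * ζ.re + t ^ 2 := by
    rw [Complex.sq_norm, Complex.sq_norm, Complex.normSq_apply, Complex.normSq_apply]
    simp only [Complex.add_re, Complex.ofReal_re, Complex.add_im, Complex.ofReal_im]
    ring
  -- The left side is `(1 - s²)‖ζ‖² + (t - s‖ζ‖)²`, and symmetrically with `t` and `‖ζ‖` exchanged;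
  -- this gives both lower bounds.
  have hlow : ‖ζ‖ ^ 2 - 2 * t * (s * ‖ζ‖) + t ^ 2 ≤ ‖(t : ℂ) + ζ‖ ^ 2 := by
    rw [hsq]; nlinarith
  refine ⟨?_, ?_, ?_⟩
  · refine le_of_sq_le_sq ?_ (norm_nonneg _)
    rw [mul_pow, Real.sq_sqrt hs2]
    nlinarith [sq_nonneg (t - s * ‖ζ‖)]
  · refine le_of_sq_le_sq ?_ (norm_nonneg _)
    rw [mul_pow, Real.sq_sqrt hs2]
    nlinarith [sq_nonneg (‖ζ‖ - s * t)]
  · have h1 : ‖ζ‖ ≤ ‖(t : ℂ) + ζ‖ + t := by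
      have := norm_sub_le ((t : ℂ) + ζ) t
      rwa [add_sub_cancel_left, Complex.norm_real, Real.norm_of_nonneg ht] at this
    rw [Complex.add_re, Complex.ofReal_re]
    nlinarith

end Sector

/-! ### Real shifts and closedness -/

section Shift

variable {Y : Type*} [NormedAddCommGroup Y] [NormedSpace ℂ Y]

theorem isResolventAt_vadd_iff {T : Y →ₗ.[ℂ] Y} {c ζ : ℂ} {R : Y →L[ℂ] Y} :
    IsResolventAt ((c • (LinearMap.id : Y →ₗ[ℂ] Y)) +ᵥ T) (c + ζ) R ↔ IsResolventAt T ζ R := by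
  have h : ∀ u : T.domain, ((c • (LinearMap.id : Y →ₗ[ℂ] Y)) +ᵥ T) u - (c + ζ) • (u : Y) =
      T u - ζ • (u : Y) := by
    intro u
    have : ((c • (LinearMap.id : Y →ₗ[ℂ] Y)) +ᵥ T) u = c • (u : Y) + T u := rfl
    rw [this]; module
  constructor
  · rintro ⟨h1, h2⟩
    refine ⟨fun y => ?_, fun u => ?_⟩
    · obtain ⟨u, hu, hy⟩ := h1 y
      exact ⟨u, hu, (h u).symm.trans hy⟩
    · rw [← h u]; exact h2 u
  · rintro ⟨h1, h2⟩
    refine ⟨fun y => ?_, fun u => ?_⟩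
    · obtain ⟨u, hu, hy⟩ := h1 y
      exact ⟨u, hu, (h u).trans hy⟩
    · have := h2 u
      rw [← h u] at this
      exact this

/-- The graph is the solution set of the continuous equation `x = R (y - ζ x)`. -/
theorem IsResolventAt.isClosed {T : Y →ₗ.[ℂ] Y} {ζ : ℂ} {R : Y →L[ℂ] Y}
    (h : IsResolventAt T ζ R) : T.IsClosed := by
  have hg : (T.graph : Set (Y × Y)) = {p | p.1 = R (p.2 - ζ • p.1)} := by
    ext ⟨x, y⟩
    rw [SetLike.mem_coe, LinearPMap.mem_graph_iff, mem_ofPred_eq]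
    constructor
    · rintro ⟨u, rfl, rfl⟩
      exact (h.2 u).symm
    · intro hx
      obtain ⟨u, hu, he⟩ := h.1 (y - ζ • x)
      rw [← hx] at hu
      refine ⟨u, hu, ?_⟩
      rw [hu] at he
      exact sub_left_injective he
  rw [LinearPMap.IsClosed, hg]
  exact isClosed_eq (by fun_prop) (by fun_prop)

end Shift

/-! ### Sectorial bounds and their stability -/

section SectorialPencil

open Filter Topology

variable {E G : Type*} [NormedAddCommGroup E] [NormedSpace ℂ E] [CompleteSpace E]
  [NormedAddCommGroup G] [NormedSpace ℂ G] [CompleteSpace G]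

/-- Resolvent bound for the pencil `T - ζ j` in the sector `Re (ζ - a) > -s |ζ - a|`. -/
def SectorialBound (j T : E →L[ℂ] G) (a s M : ℝ) : Prop :=
  ∀ ζ : ℂ, ζ ≠ 0 → -s * ‖ζ‖ < ζ.re → (pencil j T (a + ζ)).IsInvertible ∧
    ∀ y, ‖j ((pencil j T (a + ζ)).inverse y)‖ ≤ M / ‖ζ‖ * ‖y‖

/-- With `s` the sine of the angle, sectoriality becomes an estimate on the pencil; density comes
from `j` and closedness from any resolvent point. -/
theorem isHSectorial_asOperatorIn_iff {j T : E →L[ℂ] G} (hj : Function.Injective j)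
    (hd : DenseRange j) :
    IsHSectorial (asOperatorIn j.toLinearMap hj T.toLinearMap) ↔
      ∃ a s M : ℝ, 0 < s ∧ s < 1 ∧ 0 < M ∧ SectorialBound j T a s M := by
  constructor
  · rintro ⟨a, ω, hω, T₀, ⟨-, -, hsub, hb⟩, hT⟩
    -- The resolvent bound is available only for angles strictly below `ω`; half of it suffices.
    obtain ⟨M, hM, hMb⟩ := hb (ω / 2) ⟨by linarith [hω.1], by linarith [hω.1]⟩
    have hs1 : Real.sin (ω / 2) < 1 := by
      rw [← Real.sin_pi_div_two]
      exact Real.sin_lt_sin_of_lt_of_le_pi_div_two (by linarith [hω.1, Real.pi_pos]) le_rfl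
        (by linarith [hω.1, hω.2])
    refine ⟨a, Real.sin (ω / 2), M,
      Real.sin_pos_of_pos_of_lt_pi (by linarith [hω.1]) (by linarith [hω.2, Real.pi_pos]), hs1,
      hM, fun ζ h0 hζ => ?_⟩
    have hmem : ζ ∈ sector (Real.pi / 2 + ω / 2) :=
      (mem_sector_iff (by linarith [hω.1]) (by linarith [hω.1, hω.2])).2 ⟨h0, hζ⟩
    obtain ⟨R, hR⟩ := hsub (show ζ ∈ sector (Real.pi / 2 + ω) from
      ⟨hmem.1, hmem.2.trans (by linarith [hω.1])⟩)
    have hR' := isResolventAt_vadd_iff (c := (a : ℂ)).2 hR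
    rw [← hT] at hR'
    have hinv := (mem_resolvSet_asOperatorIn_iff hj).1 ⟨R, hR'⟩
    refine ⟨hinv, fun y => ?_⟩
    have h1 := hMb ζ hmem
    rw [hR.resolv_eq, hR'.unique (isResolventAt_asOperatorIn hj hinv)] at h1
    exact ContinuousLinearMap.le_of_opNorm_le _ h1 y
  · rintro ⟨a, s, M, hs0, hs1, hM, hb⟩
    set T₀ := (((-a : ℝ) : ℂ) • (LinearMap.id : G →ₗ[ℂ] G)) +ᵥ
      asOperatorIn j.toLinearMap hj T.toLinearMap with hT₀
    have hω0 : 0 < Real.arcsin s := Real.arcsin_pos.2 hs0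
    have hres : ∀ ζ ∈ sector (Real.pi / 2 + Real.arcsin s),
        IsResolventAt T₀ ζ (j ∘L (pencil j T (a + ζ)).inverse) ∧
          ∀ y, ‖j ((pencil j T (a + ζ)).inverse y)‖ ≤ M / ‖ζ‖ * ‖y‖ := by
      intro ζ hζ
      rw [mem_sector_iff hω0.le (Real.arcsin_le_pi_div_two s), Real.sin_arcsin (by linarith) hs1.le]
        at hζ
      obtain ⟨h1, h2⟩ := hb ζ hζ.1 hζ.2
      refine ⟨?_, h2⟩
      have := isResolventAt_vadd_iff (c := ((-a : ℝ) : ℂ)).2 (isResolventAt_asOperatorIn hj h1)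
      have he : ((-a : ℝ) : ℂ) + (a + ζ) = ζ := by push_cast; ring
      rwa [he] at this
    refine ⟨a, Real.arcsin s, ⟨hω0, Real.arcsin_le_pi_div_two s⟩, T₀, ⟨?_, ?_, ?_, ?_⟩, ?_⟩
    · have : (T₀.domain : Set G) = range j := rfl
      rw [this]
      exact hd
    · refine (hres 1 ?_).1.isClosed
      refine ⟨one_ne_zero, ?_⟩
      rw [Complex.arg_one, abs_zero]
      positivity
    · exact fun ζ hζ => ⟨_, (hres ζ hζ).1⟩
    · refine fun ω' hω' => ⟨M, hM, fun ζ hζ => ?_⟩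
      obtain ⟨h1, h2⟩ := hres ζ ⟨hζ.1, hζ.2.trans (by linarith [hω'.2])⟩
      rw [h1.resolv_eq]
      exact ContinuousLinearMap.opNorm_le_bound _ (by positivity) h2
    · rw [hT₀, vadd_vadd, ← add_smul]
      simp

/-- Neumann series: `N = N₀ (1 + N₀⁻¹ (N - N₀))` with a correction of norm at most `1/2`. -/
theorem isInvertible_of_norm_sub_le {N N₀ : E →L[ℂ] G} (h : N₀.IsInvertible) {K : ℝ}
    (hK : 0 < K) (hN₀ : ‖N₀.inverse‖ ≤ K) (hN : ‖N - N₀‖ ≤ (2 * K)⁻¹) :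
    N.IsInvertible := by
  set P : E →L[ℂ] E := N₀.inverse ∘L (N - N₀) with hP
  have hlt : ‖-P‖ < 1 := by
    rw [norm_neg]
    calc ‖P‖ ≤ K * (2 * K)⁻¹ := (ContinuousLinearMap.opNorm_comp_le _ _).trans (by gcongr)
      _ < 1 := by field_simp; norm_num
  have hu : IsUnit (1 - -P) := isUnit_one_sub_of_norm_lt_one hlt
  have hfac : N = N₀ ∘L (1 - -P) := by
    ext x
    simp [hP, h.self_apply_inverse]
  rw [hfac]
  exact h.comp (isInvertible_of_bijective (ContinuousLinearMap.isUnit_iff_bijective.1 hu))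

/-- Sectorial bounds persist, uniformly, under small perturbations of the operator. -/
theorem SectorialBound.eventually {j T₀ : E →L[ℂ] G} {a s M : ℝ} (hs0 : 0 < s) (hs1 : s < 1)
    (hM : 0 < M) (h : SectorialBound j T₀ a s M) :
    ∃ a' M' : ℝ, 0 < M' ∧ ∀ᶠ T in 𝓝 T₀, SectorialBound j T a' s M' := by
  have h1 : (pencil j T₀ (a + 1)).IsInvertible := (h 1 one_ne_zero (by simp; linarith)).1
  set C := ‖(pencil j T₀ (a + 1)).inverse‖ with hC
  -- The hypothesis bounds `j x`, while the perturbation acts on `x` in `E`. Writing `x` through the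
  -- inverse at `a + 1`, with `‖ζ - 1‖ ≤ 2‖ζ‖`, gives `C (1 + 2M)`; the extra `1` ensures
  -- positivity.
  set K : ℝ := C * (1 + 2 * M) + 1 with hKdef
  have hK : 0 < K := by positivity
  have hbound : ∀ ζ : ℂ, -s * ‖ζ‖ < ζ.re → 1 ≤ ‖ζ‖ → ‖(pencil j T₀ (a + ζ)).inverse‖ ≤ K := by
    intro ζ hre hζ
    obtain ⟨hi, hb⟩ := h ζ (norm_pos_iff.1 (by linarith)) hre
    refine ContinuousLinearMap.opNorm_le_bound _ hK.le fun y => ?_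
    set x := (pencil j T₀ (a + ζ)).inverse y with hx
    have hx1 : pencil j T₀ (a + 1) x = y + (ζ - 1) • j x := by
      rw [pencil_sub_pencil j T₀ (a + 1) (a + ζ), hi.self_apply_inverse]
      congr 2; ring
    have hx2 : x = (pencil j T₀ (a + 1)).inverse (y + (ζ - 1) • j x) := by
      rw [← hx1, h1.inverse_apply_self]
    have hn : ‖ζ - 1‖ ≤ 2 * ‖ζ‖ := (norm_sub_le _ _).trans (by rw [norm_one]; linarith)
    have h2 : ‖(ζ - 1) • j x‖ ≤ 2 * M * ‖y‖ := by
      rw [norm_smul]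
      calc ‖ζ - 1‖ * ‖j x‖ ≤ (2 * ‖ζ‖) * (M / ‖ζ‖ * ‖y‖) := by
            gcongr
            exact hb y
        _ = 2 * M * ‖y‖ := by field_simp
    calc ‖x‖ = ‖(pencil j T₀ (a + 1)).inverse (y + (ζ - 1) • j x)‖ := by rw [← hx2]
      _ ≤ C * ‖y + (ζ - 1) • j x‖ := ContinuousLinearMap.le_opNorm _ _
      _ ≤ C * (‖y‖ + 2 * M * ‖y‖) := by
        gcongr
        exact (norm_add_le _ _).trans (by gcongr)
      _ ≤ K * ‖y‖ := by rw [hKdef]; nlinarith [norm_nonneg y]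
  set c : ℝ := √(1 - s ^ 2) with hc
  have hc0 : 0 < c := Real.sqrt_pos.2 (by nlinarith)
  -- Moving the vertex right by `c⁻¹` keeps the new sector inside the old one, at distance at least
  -- `1` from the old vertex, where `K` applies. In the new constant `c` compares distances to the
  -- vertices and `2` pays for the perturbation.
  refine ⟨a + c⁻¹, 2 * M / c, by positivity, ?_⟩
  have hev : ∀ᶠ T in 𝓝 T₀, ‖T - T₀‖ ≤ (2 * K)⁻¹ := by
    filter_upwards [Metric.closedBall_mem_nhds T₀ (show 0 < (2 * K)⁻¹ by positivity)] with T hT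
    rwa [Metric.mem_closedBall, dist_eq_norm] at hT
  filter_upwards [hev] with T hT ζ h0 hre
  obtain ⟨hn1, hn2, hre'⟩ := norm_mul_le_norm_add hs0.le hs1 (inv_nonneg.2 hc0.le) hre
  rw [← hc] at hn1 hn2
  rw [mul_inv_cancel₀ hc0.ne'] at hn2
  have hz : ((a + c⁻¹ : ℝ) : ℂ) + ζ = a + (((c⁻¹ : ℝ) : ℂ) + ζ) := by push_cast; ring
  rw [hz]
  set ξ : ℂ := ((c⁻¹ : ℝ) : ℂ) + ζ with hξ
  obtain ⟨hi, hb⟩ := h ξ (norm_pos_iff.1 (by linarith)) hre'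
  have hKb := hbound ξ hre' hn2
  have hdiff : ∀ x, pencil j T (a + ξ) x = pencil j T₀ (a + ξ) x + (T - T₀) x := by
    intro x
    simp only [pencil_apply, sub_apply]; module
  have hinv : (pencil j T (a + ξ)).IsInvertible := by
    refine isInvertible_of_norm_sub_le hi hK hKb ?_
    have : pencil j T (a + ξ) - pencil j T₀ (a + ξ) = T - T₀ := by
      ext x; rw [sub_apply, hdiff]; abel
    rwa [this]
  refine ⟨hinv, fun y => ?_⟩
  set x := (pencil j T (a + ξ)).inverse y with hx
  -- The unperturbed bound is applied to `w`, which differs from `y` by at most half its own norm.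
  set w := pencil j T₀ (a + ξ) x with hw
  have hxw : (pencil j T₀ (a + ξ)).inverse w = x := hi.inverse_apply_self x
  have hyw : y = w + (T - T₀) x := by rw [hw, ← hdiff, hinv.self_apply_inverse]
  have hxn : ‖x‖ ≤ K * ‖w‖ := by
    rw [← hxw]; exact ContinuousLinearMap.le_of_opNorm_le _ hKb w
  have hdx : ‖(T - T₀) x‖ ≤ ‖w‖ / 2 := by
    calc ‖(T - T₀) x‖ ≤ (2 * K)⁻¹ * (K * ‖w‖) := (ContinuousLinearMap.le_opNorm _ _).trans (by gcongr)
      _ = ‖w‖ / 2 := by field_simp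
  have hwy : ‖w‖ ≤ 2 * ‖y‖ := by
    have : w = y - (T - T₀) x := by rw [hyw]; abel
    have h3 : ‖w‖ ≤ ‖y‖ + ‖(T - T₀) x‖ := by
      conv_lhs => rw [this]
      exact norm_sub_le _ _
    linarith
  have hζ : 0 < ‖ζ‖ := norm_pos_iff.2 h0
  calc ‖j x‖ ≤ M / ‖ξ‖ * ‖w‖ := by rw [← hxw]; exact hb w
    _ ≤ M / (c * ‖ζ‖) * (2 * ‖y‖) := by gcongr
    _ = 2 * M / c / ‖ζ‖ * ‖y‖ := by field_simp

/-- For `Re ζ ≥ 0` the sector condition follows from `|a| < s ‖ζ - a‖`. The radius depends only on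
`a` and `s`, so one disc serves all operators sharing these constants. -/
theorem isInvertible_pencil_of_large {j T : E →L[ℂ] G} {a s M : ℝ} (hs0 : 0 < s)
    (h : SectorialBound j T a s M) {ζ : ℂ} (hre : 0 ≤ ζ.re) (hζ : |a| + |a| / s + 1 ≤ ‖ζ‖) :
    (pencil j T ζ).IsInvertible := by
  have h1 : ‖ζ‖ ≤ ‖ζ - a‖ + |a| := by
    have := norm_add_le (ζ - a) (a : ℂ)
    rwa [sub_add_cancel, Complex.norm_real, Real.norm_eq_abs] at this
  have h2 : |a| / s < ‖ζ - a‖ := by linarith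
  have h3 : |a| < s * ‖ζ - a‖ := by rwa [div_lt_iff₀' hs0] at h2
  have h4 := (h (ζ - a) (norm_pos_iff.1 ((by positivity : 0 ≤ |a| / s).trans_lt h2)) (by
    rw [Complex.sub_re, Complex.ofReal_re]
    linarith [le_abs_self a])).1
  rwa [add_sub_cancel] at h4

/-- Invertibility is open in `(T, ζ)` jointly; the tube lemma applies. -/
theorem eventually_isInvertible_of_isCompact {j T₀ : E →L[ℂ] G} {S : Set ℂ} (hS : IsCompact S)
    (h : ∀ ζ ∈ S, (pencil j T₀ ζ).IsInvertible) :
    ∀ᶠ T in 𝓝 T₀, ∀ ζ ∈ S, (pencil j T ζ).IsInvertible :=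
  hS.eventually_forall_of_forall_eventually fun ζ hζ =>
    (isOpen_setOf_isInvertible.preimage (continuous_pencil j)).mem_nhds
      (show (T₀, ζ) ∈ _ from h ζ hζ)

end SectorialPencil

/-! ### Conjugation symmetry and complexified operators -/

namespace Complexification

variable {X Z : Type*} [NormedAddCommGroup X] [NormedSpace ℝ X]
  [NormedAddCommGroup Z] [NormedSpace ℝ Z]

/-- Complex conjugation `x + iy ↦ x - iy`. -/
def conj (v : Complexification X) : Complexification X := ⟨v.re, -v.im⟩

theorem conj_conj (v : Complexification X) : conj (conj v) = v := by
  ext <;> simp [conj]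

theorem re_sub (v w : Complexification X) : (v - w).re = v.re - w.re := by
  have := re_add (v - w) w
  rw [sub_add_cancel] at this
  rw [this, add_sub_cancel_right]

theorem im_sub (v w : Complexification X) : (v - w).im = v.im - w.im := by
  have := im_add (v - w) w
  rw [sub_add_cancel] at this
  rw [this, add_sub_cancel_right]

theorem pencil_map_conj (j T : X →L[ℝ] Z) (ζ : ℂ) (v : Complexification X) :
    pencil (map j) (map T) (starRingEnd ℂ ζ) (conj v) = conj (pencil (map j) (map T) ζ v) := by
  ext
  · simp [pencil_apply, conj, re_sub]
  · simp [pencil_apply, conj, im_sub]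
    abel

/-- A complexified real operator commutes with conjugation, so the pencils at `ζ` and its conjugate
differ only by composing with an involution on each side. -/
theorem isInvertible_pencil_map_conj [CompleteSpace X] [CompleteSpace Z] {j T : X →L[ℝ] Z} {ζ : ℂ}
    (h : (pencil (map j) (map T) ζ).IsInvertible) :
    (pencil (map j) (map T) (starRingEnd ℂ ζ)).IsInvertible := by
  have he : ⇑(pencil (map j) (map T) (starRingEnd ℂ ζ)) =
      conj ∘ pencil (map j) (map T) ζ ∘ conj := by
    funext v
    rw [Function.comp_apply, Function.comp_apply, ← pencil_map_conj, conj_conj]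
  refine isInvertible_of_bijective ?_
  rw [he]
  exact (Function.Involutive.bijective conj_conj).comp
    (h.bijective.comp (Function.Involutive.bijective conj_conj))

theorem norm_le_add (v : Complexification X) : ‖v‖ ≤ ‖v.re‖ + ‖v.im‖ := by
  rw [norm_def]
  refine ContinuousLinearMap.opNorm_le_bound _ (by positivity) fun z => ?_
  rw [reMul_apply, add_mul]
  refine (norm_sub_le _ _).trans ?_
  rw [norm_smul, norm_smul, mul_comm, mul_comm ‖z.im‖]
  gcongr
  · exact Complex.abs_re_le_norm z
  · exact Complex.abs_im_le_norm z

theorem denseRange_map {T : X →L[ℝ] Z} (hT : DenseRange T) : DenseRange (map T) := by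
  intro v
  rw [Metric.mem_closure_iff]
  intro ε hε
  obtain ⟨x, hx⟩ := Metric.denseRange_iff.1 hT v.re (ε / 2) (half_pos hε)
  obtain ⟨y, hy⟩ := Metric.denseRange_iff.1 hT v.im (ε / 2) (half_pos hε)
  refine ⟨_, ⟨⟨x, y⟩, rfl⟩, ?_⟩
  rw [dist_eq_norm] at hx hy ⊢
  refine (norm_le_add _).trans_lt ?_
  rw [re_sub, im_sub]
  simp only [map_re, map_im]
  linarith

theorem bijective_of_map {T : X →L[ℝ] Z} (h : Function.Bijective (map T)) :
    Function.Bijective T := by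
  refine ⟨fun x y hxy => ?_, fun z => ?_⟩
  · have : (⟨x, 0⟩ : Complexification X) = ⟨y, 0⟩ := by
      apply h.1
      ext
      · exact hxy
      · rfl
    exact congrArg re this
  · obtain ⟨v, hv⟩ := h.2 ⟨z, 0⟩
    exact ⟨v.re, congrArg re hv⟩

theorem norm_map_le (T : X →L[ℝ] Z) : ‖map T‖ ≤ ‖T‖ :=
  LinearMap.mkContinuous_norm_le _ (norm_nonneg _) _

theorem re_real_smul (c : ℝ) (v : Complexification X) : (c • v).re = c • v.re := by
  change ((c : ℂ) • v).re = _
  rw [re_smul, Complex.ofReal_re, Complex.ofReal_im, zero_smul, sub_zero]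

theorem im_real_smul (c : ℝ) (v : Complexification X) : (c • v).im = c • v.im := by
  change ((c : ℂ) • v).im = _
  rw [im_smul, Complex.ofReal_re, Complex.ofReal_im, zero_smul, add_zero]

/-- `map` as a bounded real-linear map. -/
def mapCLM : (X →L[ℝ] Z) →L[ℝ] (Complexification X →L[ℂ] Complexification Z) :=
  LinearMap.mkContinuous
    { toFun := map
      map_add' := fun S T => by ext v <;> simp
      map_smul' := fun c T => by
        ext v
        · exact (re_real_smul c (map T v)).symm
        · exact (im_real_smul c (map T v)).symm }
    1 (fun T => by simpa using norm_map_le T)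

end Complexification

/-! ### Analytic dependence of the linearization; equilibria as a graph -/

section LinOp

open Filter Topology

variable {X Z : Type*} [NormedAddCommGroup X] [NormedSpace ℝ X]
  [NormedAddCommGroup Z] [NormedSpace ℝ Z] {n : ℕ}

/-- The bounded operator underlying `linearization`. -/
def linOp (F : X × EuclideanSpace ℝ (Fin n) → Z) (p : X × EuclideanSpace ℝ (Fin n)) :
    Complexification X →L[ℂ] Complexification Z :=
  Complexification.map (fderiv ℝ (fun y => F (y, p.2)) p.1)

theorem linearization_eq (ι : X →L[ℝ] Z) (hι : Function.Injective ι)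
    (F : X × EuclideanSpace ℝ (Fin n) → Z) (x : X) (ε : EuclideanSpace ℝ (Fin n)) :
    linearization ι hι F x ε = asOperatorIn (Complexification.map ι).toLinearMap
      (Complexification.map_injective hι) (linOp F (x, ε)).toLinearMap := rfl

theorem fderiv_fst_eq {F : X × EuclideanSpace ℝ (Fin n) → Z} {p : X × EuclideanSpace ℝ (Fin n)}
    (h : DifferentiableAt ℝ F p) :
    fderiv ℝ (fun y => F (y, p.2)) p.1 = fderiv ℝ F p ∘L ContinuousLinearMap.inl ℝ X _ := by
  have h1 : HasFDerivAt F (fderiv ℝ F p) (p.1, p.2) := h.hasFDerivAt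
  exact (h1.comp p.1 (hasFDerivAt_prodMk_left p.1 p.2)).fderiv

/-- The full derivative of `F` is analytic; restricting it to `X` and complexifying are bounded
linear operations. -/
theorem analyticAt_linOp [CompleteSpace Z] {F : X × EuclideanSpace ℝ (Fin n) → Z}
    {p : X × EuclideanSpace ℝ (Fin n)} (h : AnalyticAt ℝ F p) :
    AnalyticAt ℝ (linOp F) p := by
  have h1 : AnalyticAt ℝ (fun q => Complexification.mapCLM
      ((ContinuousLinearMap.compL ℝ X (X × EuclideanSpace ℝ (Fin n)) Z).flip
        (ContinuousLinearMap.inl ℝ X _) (fderiv ℝ F q))) p :=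
    (ContinuousLinearMap.analyticAt _ _).comp
      ((ContinuousLinearMap.analyticAt _ _).comp h.fderiv)
  refine h1.congr ?_
  filter_upwards [h.eventually_analyticAt] with q hq
  rw [linOp, fderiv_fst_eq hq.differentiableAt]
  rfl

variable [CompleteSpace X] [CompleteSpace Z]

theorem conj_mem_spec_linearization {ι : X →L[ℝ] Z} {hι : Function.Injective ι}
    {F : X × EuclideanSpace ℝ (Fin n) → Z} {x : X} {ε : EuclideanSpace ℝ (Fin n)} {ζ : ℂ}
    (h : ζ ∈ spec (linearization ι hι F x ε)) :
    starRingEnd ℂ ζ ∈ spec (linearization ι hι F x ε) := by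
  rw [linearization_eq, mem_spec_asOperatorIn_iff] at h ⊢
  intro hc
  apply h
  have := Complexification.isInvertible_pencil_map_conj hc
  rwa [Complex.conj_conj] at this

/-- Equilibria near a point with invertible linearization form an analytic graph. -/
theorem exists_isLocalParametrization {U : Set X} (hU : IsOpen U)
    {V : Set (EuclideanSpace ℝ (Fin n))} (hV : IsOpen V)
    {F : X × EuclideanSpace ℝ (Fin n) → Z} {x₀ : X} {ε₀ : EuclideanSpace ℝ (Fin n)} (hx₀ : x₀ ∈ U)
    (hε₀ : ε₀ ∈ V) (hF : AnalyticAt ℝ F (x₀, ε₀)) (h0 : F (x₀, ε₀) = 0)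
    (hbij : Function.Bijective (fderiv ℝ (fun y => F (y, ε₀)) x₀)) :
    ∃ (Nx : Set X) (Nε : Set (EuclideanSpace ℝ (Fin n))) (Xloc : EuclideanSpace ℝ (Fin n) → X),
      IsLocalParametrization U V F x₀ ε₀ Nx Nε Xloc := by
  set f : EuclideanSpace ℝ (Fin n) × X → Z := fun q => F (q.2, q.1) with hf
  -- Here `⊤` is the analytic class, so the implicit function is analytic and not merely smooth.
  have hfan : ContDiffAt ℝ ⊤ f (ε₀, x₀) := by
    have h1 : AnalyticAt ℝ f (ε₀, x₀) :=
      AnalyticAt.fun_comp (f := fun q : EuclideanSpace ℝ (Fin n) × X => (q.2, q.1)) hF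
        (analyticAt_snd.prod analyticAt_fst)
    exact h1.contDiffAt
  have hpart : fderiv ℝ f (ε₀, x₀) ∘L .inr ℝ (EuclideanSpace ℝ (Fin n)) X =
      fderiv ℝ (fun y => F (y, ε₀)) x₀ := by
    have h1 : HasFDerivAt f (fderiv ℝ f (ε₀, x₀)) (ε₀, x₀) :=
      (hfan.differentiableAt (by simp)).hasFDerivAt
    exact (h1.comp x₀ (hasFDerivAt_prodMk_right ε₀ x₀)).fderiv.symm
  have hinv : (fderiv ℝ f (ε₀, x₀) ∘L .inr ℝ (EuclideanSpace ℝ (Fin n)) X).IsInvertible := by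
    rw [hpart]
    exact ⟨ContinuousLinearEquiv.ofBijective _ (LinearMap.ker_eq_bot.2 hbij.1)
      (LinearMap.range_eq_top.2 hbij.2), ContinuousLinearEquiv.coe_ofBijective _ _ _⟩
  set g := hfan.implicitFunction (by simp) hinv
  have hgan : AnalyticAt ℝ g ε₀ := (hfan.contDiffAt_implicitFunction (by simp) hinv).analyticAt
  have hg0 : g ε₀ = x₀ := hfan.implicitFunction_apply_self (by simp) hinv
  have hgiff : ∀ᶠ q in 𝓝 (ε₀, x₀), f q = f (ε₀, x₀) ↔ g q.1 = q.2 :=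
    hfan.eventually_apply_eq_iff_implicitFunction (by simp) hinv
  rw [nhds_prod_eq, eventually_prod_iff] at hgiff
  obtain ⟨pa, hpa, pb, hpb, hab⟩ := hgiff
  obtain ⟨Nx, hNx, hNxo, hxN⟩ := eventually_nhds_iff.1 (hpb.and (hU.mem_nhds hx₀))
  have hgN : ∀ᶠ ε in 𝓝 ε₀, g ε ∈ Nx :=
    hgan.continuousAt.eventually_mem (by rw [hg0]; exact hNxo.mem_nhds hxN)
  have hVev : ∀ᶠ ε in 𝓝 ε₀, ε ∈ V := hV.mem_nhds hε₀
  obtain ⟨Nε, hNε, hNεo, hεN⟩ := eventually_nhds_iff.1 (hpa.and (hVev.and (hgN.and hgan.eventually_analyticAt)))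
  refine ⟨Nx, Nε, g, hNxo, hNεo, hxN, hεN, fun x hx => (hNx x hx).2, fun ε hε => (hNε ε hε).2.1,
    fun ε hε => (hNε ε hε).2.2.2, fun ε hε => (hNε ε hε).2.2.1, hg0, fun x hx ε hε => ?_⟩
  have := hab (hNε ε hε).1 (hNx x hx).1
  simp only [hf, h0] at this
  rw [this, eq_comm]

end LinOp

/-! ### Spectrum along a local parametrization -/

section Perturbation

open Filter Topology

variable {X Z : Type*} [NormedAddCommGroup X] [NormedSpace ℝ X] [CompleteSpace X]
  [NormedAddCommGroup Z] [NormedSpace ℝ Z] [CompleteSpace Z] {n : ℕ}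
  {ι : X →L[ℝ] Z} {hι : Function.Injective ι} {U : Set X}
  {V : Set (EuclideanSpace ℝ (Fin n))} {F : X × EuclideanSpace ℝ (Fin n) → Z}
  {x₀ : X} {ε₀ : EuclideanSpace ℝ (Fin n)} {Nx : Set X} {Nε : Set (EuclideanSpace ℝ (Fin n))}
  {Xloc : EuclideanSpace ℝ (Fin n) → X}

/-- The critical eigenvalues have nonzero imaginary part, so `0` is a resolvent point; bijectivity
descends from the complexification. -/
theorem IsCriticalPoint.bijective_fderiv (h : IsCriticalPoint ι hι U V F x₀ ε₀) :
    Function.Bijective (fderiv ℝ (fun y => F (y, ε₀)) x₀) := by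
  obtain ⟨-, -, -, -, l, hl, hspec, -, -⟩ := h
  have h0 : (0 : ℂ) ∉ spec (linearization ι hι F x₀ ε₀) := by
    intro h0
    have : (0 : ℂ) ∈ ({l, starRingEnd ℂ l} : Set ℂ) := by
      rw [← hspec]; exact ⟨h0, Complex.zero_re⟩
    rcases this with h1 | h1
    · rw [← h1] at hl; simp at hl
    · have := congrArg Complex.im (mem_singleton_iff.1 h1)
      rw [Complex.conj_im, Complex.zero_im] at this
      linarith
  rw [linearization_eq, mem_spec_asOperatorIn_iff, not_not] at h0
  have : pencil (Complexification.map ι) (linOp F (x₀, ε₀)) 0 = linOp F (x₀, ε₀) := by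
    simp [pencil]
  rw [this] at h0
  exact Complexification.bijective_of_map h0.bijective

theorem IsLocalParametrization.analyticAt_linOp (hF : AnalyticOnNhd ℝ F (U ×ˢ V))
    (h : IsLocalParametrization U V F x₀ ε₀ Nx Nε Xloc) {ε : EuclideanSpace ℝ (Fin n)}
    (hε : ε ∈ Nε) : AnalyticAt ℝ (fun ε => linOp F (Xloc ε, ε)) ε :=
  AnalyticAt.fun_comp (f := fun ε => (Xloc ε, ε))
    (HopfSpec.analyticAt_linOp (hF (Xloc ε, ε) ⟨h.Nx_subset (h.mapsTo hε), h.Nε_subset hε⟩))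
    ((h.analytic ε hε).prod analyticAt_id)

theorem IsLocalParametrization.tendsto_linOp (hF : AnalyticOnNhd ℝ F (U ×ˢ V))
    (h : IsLocalParametrization U V F x₀ ε₀ Nx Nε Xloc) :
    Tendsto (fun ε => linOp F (Xloc ε, ε)) (𝓝 ε₀) (𝓝 (linOp F (x₀, ε₀))) := by
  have := (h.analyticAt_linOp hF h.mem_Nε).continuousAt.tendsto
  rwa [h.base] at this

theorem IsLocalParametrization.eventually_mem
    (h : IsLocalParametrization U V F x₀ ε₀ Nx Nε Xloc) : ∀ᶠ ε in 𝓝 ε₀, ε ∈ Nε :=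
  h.isOpen_Nε.mem_nhds h.mem_Nε

/-- A simple isolated eigenvalue continues analytically along a local parametrization. -/
theorem IsLocalParametrization.exists_eigenvalue (hF : AnalyticOnNhd ℝ F (U ×ˢ V))
    (h : IsLocalParametrization U V F x₀ ε₀ Nx Nε Xloc) {l : ℂ}
    (hl : IsSimpleIsolatedEigenvalue (linearization ι hι F x₀ ε₀) l) :
    ∃ (lam : EuclideanSpace ℝ (Fin n) → ℂ) (δ : ℝ), 0 < δ ∧ lam ε₀ = l ∧
      ∀ᶠ ε in 𝓝 ε₀, AnalyticAt ℝ lam ε ∧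
        IsSimpleIsolatedEigenvalue (linearization ι hι F (Xloc ε) ε) (lam ε) ∧
        ∀ ζ ∈ Metric.ball l δ, ζ ∈ spec (linearization ι hι F (Xloc ε) ε) ↔ ζ = lam ε := by
  rw [linearization_eq] at hl
  obtain ⟨Λ, δ, hδ, hΛan, hΛ0, hΛ⟩ := exists_analyticAt_eigenvalue _ hl
  have ht := h.tendsto_linOp hF
  refine ⟨fun ε => Λ (linOp F (Xloc ε, ε)), δ, hδ, by simp only [h.base, hΛ0], ?_⟩
  filter_upwards [ht.eventually hΛ, ht.eventually hΛan.eventually_analyticAt, h.eventually_mem]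
    with ε h1 h2 h3
  exact ⟨AnalyticAt.fun_comp (f := fun ε => linOp F (Xloc ε, ε)) h2.restrictScalars
    (h.analyticAt_linOp hF h3), h1⟩

theorem IsLocalParametrization.exists_isPerturbedEigenvaluePair
    (hF : AnalyticOnNhd ℝ F (U ×ˢ V)) (h : IsLocalParametrization U V F x₀ ε₀ Nx Nε Xloc)
    (hc : IsCriticalPoint ι hι U V F x₀ ε₀) :
    ∃ (N₁ : Set (EuclideanSpace ℝ (Fin n))) (lp lm : EuclideanSpace ℝ (Fin n) → ℂ),
      IsPerturbedEigenvaluePair ι hι F ε₀ Nε Xloc N₁ lp lm := by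
  obtain ⟨-, -, -, -, l, hl, hspec, hp, hm⟩ := hc
  have hre : l.re = 0 := by
    have : l ∈ spec (linearization ι hι F x₀ ε₀) ∩ {ζ : ℂ | ζ.re = 0} := by
      rw [hspec]; exact mem_insert _ _
    exact this.2
  obtain ⟨lp, δp, -, hlp0, hlp⟩ := h.exists_eigenvalue hF hp
  obtain ⟨lm, δm, -, hlm0, hlm⟩ := h.exists_eigenvalue hF hm
  obtain ⟨N₁, hN₁, hN₁o, hεN₁⟩ := eventually_nhds_iff.1 (hlp.and (hlm.and h.eventually_mem))
  exact ⟨N₁, lp, lm, hN₁o, hεN₁, fun ε hε => (hN₁ ε hε).2.2, fun ε hε => (hN₁ ε hε).1.1,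
    fun ε hε => (hN₁ ε hε).2.1.1, by rw [hlp0, hre], by rwa [hlp0], by rw [hlm0, hlp0],
    fun ε hε => (hN₁ ε hε).1.2.1, fun ε hε => (hN₁ ε hε).2.1.2.1⟩

theorem isHSectorial_linearization_iff (hd : DenseRange ι) {x : X}
    {ε : EuclideanSpace ℝ (Fin n)} :
    IsHSectorial (linearization ι hι F x ε) ↔ ∃ a s M : ℝ, 0 < s ∧ s < 1 ∧ 0 < M ∧
      SectorialBound (Complexification.map ι) (linOp F (x, ε)) a s M := by
  rw [linearization_eq]
  exact isHSectorial_asOperatorIn_iff (Complexification.map_injective hι)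
    (Complexification.denseRange_map hd)

theorem IsLocalParametrization.eventually_isHSectorial (hd : DenseRange ι)
    (hF : AnalyticOnNhd ℝ F (U ×ˢ V)) (h : IsLocalParametrization U V F x₀ ε₀ Nx Nε Xloc)
    (hs : IsHSectorial (linearization ι hι F x₀ ε₀)) :
    ∀ᶠ ε in 𝓝 ε₀, IsHSectorial (linearization ι hι F (Xloc ε) ε) := by
  obtain ⟨a, s, M, hs0, hs1, hM, hb⟩ := (isHSectorial_linearization_iff hd).1 hs
  obtain ⟨a', M', hM', hev⟩ := hb.eventually hs0 hs1 hM
  filter_upwards [(h.tendsto_linOp hF).eventually hev] with ε hε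
  exact (isHSectorial_linearization_iff hd).2 ⟨a', s, M', hs0, hs1, hM', hε⟩

/-- Near a critical point the perturbed eigenvalues are conjugate and they alone can lie in the
closed right half-plane. -/
theorem IsLocalParametrization.eventually_spec (hd : DenseRange ι)
    (hF : AnalyticOnNhd ℝ F (U ×ˢ V)) (h : IsLocalParametrization U V F x₀ ε₀ Nx Nε Xloc)
    (hc : IsCriticalPoint ι hι U V F x₀ ε₀) (hs : IsHSectorial (linearization ι hι F x₀ ε₀))
    {N₁ : Set (EuclideanSpace ℝ (Fin n))} {lp lm : EuclideanSpace ℝ (Fin n) → ℂ}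
    (hpair : IsPerturbedEigenvaluePair ι hι F ε₀ Nε Xloc N₁ lp lm) :
    ∀ᶠ ε in 𝓝 ε₀, lm ε = starRingEnd ℂ (lp ε) ∧
      ∀ ζ ∈ spec (linearization ι hι F (Xloc ε) ε), 0 ≤ ζ.re → ζ = lp ε ∨ ζ = lm ε := by
  obtain ⟨-, -, -, hsub, l, hl, hspec, hp, hm⟩ := hc
  have hlpspec : lp ε₀ ∈ spec (linearization ι hι F x₀ ε₀) := by
    have := (hpair.simple_lp ε₀ hpair.mem).1.mem_spec
    rwa [h.base] at this
  have hlp0 : lp ε₀ = l := by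
    have : lp ε₀ ∈ ({l, starRingEnd ℂ l} : Set ℂ) := by
      rw [← hspec]; exact ⟨hlpspec, hpair.re_base⟩
    rcases this with h1 | h1
    · exact h1
    · have h2 := hpair.im_base
      rw [mem_singleton_iff.1 h1, Complex.conj_im] at h2
      linarith
  have hlm0 : lm ε₀ = starRingEnd ℂ l := by rw [hpair.conj_base, hlp0]
  obtain ⟨mp, δp, hδp, -, hmp⟩ := h.exists_eigenvalue hF hp
  obtain ⟨mm, δm, hδm, -, hmm⟩ := h.exists_eigenvalue hF hm
  obtain ⟨a, s, M, hs0, hs1, hM, hb⟩ := (isHSectorial_linearization_iff hd).1 hs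
  obtain ⟨a', M', hM', hev⟩ := hb.eventually hs0 hs1 hM
  -- Beyond this radius no nearby operator has spectrum with nonnegative real part. The compact rest
  -- `S` omits the balls about the two critical eigenvalues, so by criticality it contains no
  -- unperturbed spectrum.
  set R : ℝ := |a'| + |a'| / s + 1
  set S : Set ℂ := (Metric.closedBall 0 R ∩ {ζ | 0 ≤ ζ.re}) \
    (Metric.ball l δp ∪ Metric.ball (starRingEnd ℂ l) δm) with hS
  have hScomp : IsCompact S :=
    ((isCompact_closedBall 0 R).inter_right
      (isClosed_le continuous_const Complex.continuous_re)).diff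
      (Metric.isOpen_ball.union Metric.isOpen_ball)
  have hSinv : ∀ ζ ∈ S, (pencil (Complexification.map ι) (linOp F (x₀, ε₀)) ζ).IsInvertible := by
    rintro ζ ⟨⟨-, hre⟩, hnot⟩
    by_contra hcon
    rw [← mem_spec_asOperatorIn_iff (Complexification.map_injective hι), ← linearization_eq ι hι]
      at hcon
    have hmem : ζ ∈ ({l, starRingEnd ℂ l} : Set ℂ) := by
      rw [← hspec]; exact ⟨hcon, le_antisymm (hsub hcon) hre⟩
    rcases hmem with h1 | h1
    · exact hnot (Or.inl (by rw [h1]; exact Metric.mem_ball_self hδp))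
    · exact hnot (Or.inr (by rw [mem_singleton_iff.1 h1]; exact Metric.mem_ball_self hδm))
  have ht := h.tendsto_linOp hF
  have hlpc : ContinuousAt lp ε₀ := (hpair.analytic_lp ε₀ hpair.mem).continuousAt
  have hlmc : ContinuousAt lm ε₀ := (hpair.analytic_lm ε₀ hpair.mem).continuousAt
  have e1 : ∀ᶠ ε in 𝓝 ε₀, lp ε ∈ Metric.ball l δp :=
    hlpc.eventually_mem (by rw [hlp0]; exact Metric.ball_mem_nhds _ hδp)
  have e2 : ∀ᶠ ε in 𝓝 ε₀, lm ε ∈ Metric.ball (starRingEnd ℂ l) δm :=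
    hlmc.eventually_mem (by rw [hlm0]; exact Metric.ball_mem_nhds _ hδm)
  have e3 : ∀ᶠ ε in 𝓝 ε₀, starRingEnd ℂ (lm ε) ∈ Metric.ball l δp := by
    have hcc : ContinuousAt (fun ε => starRingEnd ℂ (lm ε)) ε₀ :=
      Complex.continuous_conj.continuousAt.comp hlmc
    refine hcc.eventually_mem ?_
    simp only [hlm0, Complex.conj_conj]
    exact Metric.ball_mem_nhds _ hδp
  have e4 : ∀ᶠ ε in 𝓝 ε₀, ε ∈ N₁ := hpair.isOpen.mem_nhds hpair.mem
  filter_upwards [hmp, hmm, ht.eventually hev,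
    ht.eventually (eventually_isInvertible_of_isCompact hScomp hSinv), e1, e2, e3, e4]
    with ε hmpε hmmε hbε hSε h1 h2 h3 h4
  -- Each ball contains a single spectral point, which identifies the given eigenvalues with the
  -- constructed ones and, since the spectrum is symmetric, the conjugate of `lm ε` with `lp ε`.
  have hlpε : lp ε = mp ε := (hmpε.2.2 _ h1).1 (hpair.simple_lp ε h4).1.mem_spec
  have hlmspec := (hpair.simple_lm ε h4).1.mem_spec
  have hlmε : lm ε = mm ε := (hmmε.2.2 _ h2).1 hlmspec
  have hconj : starRingEnd ℂ (lm ε) = mp ε :=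
    (hmpε.2.2 _ h3).1 (conj_mem_spec_linearization hlmspec)
  refine ⟨by rw [hlpε, ← hconj, Complex.conj_conj], fun ζ hζ hre => ?_⟩
  by_cases hp' : ζ ∈ Metric.ball l δp
  · exact Or.inl (hlpε ▸ (hmpε.2.2 ζ hp').1 hζ)
  by_cases hm' : ζ ∈ Metric.ball (starRingEnd ℂ l) δm
  · exact Or.inr (hlmε ▸ (hmmε.2.2 ζ hm').1 hζ)
  exfalso
  rw [linearization_eq, mem_spec_asOperatorIn_iff] at hζ
  rcases le_total R ‖ζ‖ with hR | hR
  · exact hζ (isInvertible_pencil_of_large hs0 hbε hre hR)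
  · exact hζ (hSε ζ ⟨⟨by simpa using hR, hre⟩, fun hu => hu.elim hp' hm'⟩)

/-- Any spectral point on the imaginary axis must be one of `λ±`, so criticality forces `𝔯 = 0`.
Conversely, `𝔯 = 0` puts both on the axis, with no other spectrum in the closed right half-plane. -/
theorem IsLocalParametrization.eventually_isCriticalPoint_iff (hd : DenseRange ι)
    (hF : AnalyticOnNhd ℝ F (U ×ˢ V)) (h : IsLocalParametrization U V F x₀ ε₀ Nx Nε Xloc)
    (hc : IsCriticalPoint ι hι U V F x₀ ε₀) (hs : IsHSectorial (linearization ι hι F x₀ ε₀))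
    {N₁ : Set (EuclideanSpace ℝ (Fin n))} {lp lm : EuclideanSpace ℝ (Fin n) → ℂ}
    (hpair : IsPerturbedEigenvaluePair ι hι F ε₀ Nε Xloc N₁ lp lm) :
    ∀ᶠ ε in 𝓝 ε₀, lm ε = starRingEnd ℂ (lp ε) ∧
      (IsCriticalPoint ι hι U V F (Xloc ε) ε ↔ (lp ε).re = 0) := by
  have him : ∀ᶠ ε in 𝓝 ε₀, 0 < (lp ε).im := by
    have : ContinuousAt (fun ε => (lp ε).im) ε₀ :=
      Complex.continuous_im.continuousAt.comp (hpair.analytic_lp ε₀ hpair.mem).continuousAt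
    exact this.eventually (lt_mem_nhds hpair.im_base)
  have hN₁ : ∀ᶠ ε in 𝓝 ε₀, ε ∈ N₁ := hpair.isOpen.mem_nhds hpair.mem
  filter_upwards [h.eventually_spec hd hF hc hs hpair, him, hN₁] with ε ⟨hconj, hsp⟩ him hN₁
  refine ⟨hconj, ?_, fun hre => ?_⟩
  · rintro ⟨-, -, -, -, l, -, hspec, -, -⟩
    have hl : l ∈ spec (linearization ι hι F (Xloc ε) ε) ∩ {ζ : ℂ | ζ.re = 0} := by
      rw [hspec]; exact mem_insert _ _
    have hre : l.re = 0 := hl.2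
    rcases hsp l hl.1 hre.ge with h1 | h1
    · rw [← h1, hre]
    · rw [hconj] at h1
      rw [h1, Complex.conj_re] at hre
      exact hre
  · have hNε := hpair.subset hN₁
    have hXN := h.mapsTo hNε
    have hsplp := hpair.simple_lp ε hN₁
    have hsplm := hpair.simple_lm ε hN₁
    have hzero : ∀ ζ ∈ spec (linearization ι hι F (Xloc ε) ε), 0 ≤ ζ.re → ζ.re = 0 := by
      intro ζ hζ h0
      rcases hsp ζ hζ h0 with h1 | h1
      · rw [h1, hre]
      · rw [h1, hconj, Complex.conj_re, hre]
    refine ⟨h.Nx_subset hXN, h.Nε_subset hNε, (h.equilibria _ hXN ε hNε).2 rfl, fun ζ hζ => ?_,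
      lp ε, him, ?_, hsplp, hconj ▸ hsplm⟩
    · by_contra hcon
      have h0 : 0 < ζ.re := not_le.1 hcon
      exact h0.ne' (hzero ζ hζ h0.le)
    · ext ζ
      constructor
      · rintro ⟨hζ, h0⟩
        rw [← hconj]
        exact hsp ζ hζ (le_of_eq (Eq.symm h0))
      · rintro (rfl | h1)
        · exact ⟨hsplp.1.mem_spec, hre⟩
        · rw [mem_singleton_iff] at h1
          refine ⟨?_, ?_⟩
          · rw [h1, ← hconj]; exact hsplm.1.mem_spec
          · change ζ.re = 0
            rw [h1, Complex.conj_re, hre]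

end Perturbation

/-! ### Regular level sets -/

section LevelSet

open Filter Topology
open scoped ContDiff

/-- A regular zero set of a scalar analytic function is locally an analytic graph over a
hyperplane. -/
theorem exists_analytic_parametrization_zeroSet {n : ℕ} (hn : 1 ≤ n)
    {f : EuclideanSpace ℝ (Fin n) → ℝ} {a : EuclideanSpace ℝ (Fin n)} (hf : AnalyticAt ℝ f a)
    (hf' : fderiv ℝ f a ≠ 0) {N : Set (EuclideanSpace ℝ (Fin n))} (hN : N ∈ 𝓝 a) :
    ∃ (N' : Set (EuclideanSpace ℝ (Fin n))) (Ω : Set (EuclideanSpace ℝ (Fin (n - 1))))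
      (g : EuclideanSpace ℝ (Fin (n - 1)) → EuclideanSpace ℝ (Fin n))
      (π : EuclideanSpace ℝ (Fin n) →L[ℝ] EuclideanSpace ℝ (Fin (n - 1))),
      IsOpen N' ∧ a ∈ N' ∧ N' ⊆ N ∧ IsOpen Ω ∧ AnalyticOnNhd ℝ g Ω ∧ (∀ t ∈ Ω, π (g t) = t) ∧
        g '' Ω = {x ∈ N' | f x = 0} := by
  set f' := fderiv ℝ f a with hf'def
  have hker : Module.finrank ℝ (LinearMap.ker f'.toLinearMap) = n - 1 := by
    have h1 := f'.toLinearMap.finrank_range_add_finrank_ker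
    have hsurj : LinearMap.range f'.toLinearMap = ⊤ := by
      refine LinearMap.range_eq_top.2 (LinearMap.surjective ?_)
      intro h
      exact hf' (ContinuousLinearMap.coe_injective h)
    rw [hsurj, finrank_top, Module.finrank_self, finrank_euclideanSpace_fin] at h1
    omega
  have : T2Space (EuclideanSpace ℝ (Fin (n - 1))) := TopologicalSpace.t2Space_of_metrizableSpace
  set e : LinearMap.ker f'.toLinearMap ≃L[ℝ] EuclideanSpace ℝ (Fin (n - 1)) :=
    ContinuousLinearEquiv.ofFinrankEq (by rw [hker, finrank_euclideanSpace_fin])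
  -- The tangential coordinates: projection onto the kernel of `f'`, identified with `ℝⁿ⁻¹`.
  -- Together with `f'` they form an isomorphism.
  set π : EuclideanSpace ℝ (Fin n) →L[ℝ] EuclideanSpace ℝ (Fin (n - 1)) :=
    e.toContinuousLinearMap ∘L (LinearMap.ker f'.toLinearMap).orthogonalProjectionOnto with hπ
  have hinj : Function.Injective (f'.prod π) := by
    rw [injective_iff_map_eq_zero]
    intro v hv
    have h1 : f' v = 0 := congrArg Prod.fst hv
    have h2 : π v = 0 := congrArg Prod.snd hv
    have h3 : (LinearMap.ker f'.toLinearMap).orthogonalProjectionOnto v = 0 :=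
      e.injective (h2.trans (map_zero e).symm)
    have hmem : v ∈ LinearMap.ker f'.toLinearMap := h1
    have h4 := (LinearMap.ker f'.toLinearMap).orthogonalProjectionOnto_mem_subspace_eq_self ⟨v, hmem⟩
    rw [h3] at h4
    exact (congrArg Subtype.val h4).symm
  set L : EuclideanSpace ℝ (Fin n) ≃L[ℝ] ℝ × EuclideanSpace ℝ (Fin (n - 1)) :=
    (LinearEquiv.ofInjectiveOfFinrankEq (f'.prod π).toLinearMap hinj (by
      rw [Module.finrank_prod, Module.finrank_self, finrank_euclideanSpace_fin,
        finrank_euclideanSpace_fin]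
      omega)).toContinuousLinearEquiv with hL
  have hLcoe : (L : EuclideanSpace ℝ (Fin n) →L[ℝ] ℝ × EuclideanSpace ℝ (Fin (n - 1))) =
      f'.prod π := by
    ext v <;> rfl
  -- This local diffeomorphism straightens the zero set to `{0} × ℝⁿ⁻¹`; its inverse on that slice
  -- is the parametrization, with left inverse `π`.
  set Φ : EuclideanSpace ℝ (Fin n) → ℝ × EuclideanSpace ℝ (Fin (n - 1)) := fun x => (f x, π x)
    with hΦ
  have hΦc : ContDiffAt ℝ ω Φ a := hf.contDiffAt.prodMk π.contDiff.contDiffAt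
  have hΦ' : HasFDerivAt Φ
      (L : EuclideanSpace ℝ (Fin n) →L[ℝ] ℝ × EuclideanSpace ℝ (Fin (n - 1))) a := by
    rw [hLcoe]
    exact hf.differentiableAt.hasFDerivAt.prodMk π.hasFDerivAt
  set H := hΦc.toOpenPartialHomeomorph Φ hΦ' (by simp)
  have hHcoe : ∀ x, H x = (f x, π x) := fun x => rfl
  have has : a ∈ H.source := hΦc.mem_toOpenPartialHomeomorph_source hΦ' (by simp)
  have hHa : H.symm (H a) = a := H.left_inv has
  have hsymm : AnalyticAt ℝ H.symm (H a) := by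
    refine ContDiffAt.analyticAt (H.contDiffAt_symm (f₀' := L) (H.map_source has) ?_ ?_)
    · rw [hHa]; exact hΦ'
    · rw [hHa]; exact hΦc
  have hev : ∀ᶠ y in 𝓝 (H a), y ∈ H.target ∧ AnalyticAt ℝ H.symm y ∧ H.symm y ∈ N := by
    have htgt : ∀ᶠ y in 𝓝 (H a), y ∈ H.target := H.open_target.mem_nhds (H.map_source has)
    refine htgt.and (hsymm.eventually_analyticAt.and ?_)
    exact hsymm.continuousAt (by rwa [hHa])
  obtain ⟨O, hO, hOo, haO⟩ := eventually_nhds_iff.1 hev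
  refine ⟨H.source ∩ H ⁻¹' O, {t | ((0 : ℝ), t) ∈ O}, fun t => H.symm (0, t), π,
    H.isOpen_inter_preimage hOo, ⟨has, haO⟩, ?_, hOo.preimage (by fun_prop), ?_, ?_, ?_⟩
  · rintro x ⟨hx, hxO⟩
    have := (hO _ hxO).2.2
    rwa [H.left_inv hx] at this
  · intro t ht
    exact AnalyticAt.fun_comp (f := fun t => ((0 : ℝ), t)) (hO _ ht).2.1
      (analyticAt_const.prod analyticAt_id)
  · intro t ht
    have := H.right_inv (hO _ ht).1
    rw [hHcoe] at this
    exact congrArg Prod.snd this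
  · ext x
    constructor
    · rintro ⟨t, ht, rfl⟩
      have h1 := H.right_inv (hO _ ht).1
      refine ⟨⟨H.map_target (hO _ ht).1, ?_⟩, ?_⟩
      · rw [mem_preimage, h1]; exact ht
      · rw [hHcoe] at h1
        exact congrArg Prod.fst h1
    · rintro ⟨⟨hx, hxO⟩, hx0⟩
      have h1 : H x = (0, π x) := by rw [hHcoe, hx0]
      refine ⟨π x, ?_, ?_⟩
      · change (0, π x) ∈ O
        rw [← h1]; exact hxO
      · change H.symm (0, π x) = x
        rw [← h1, H.left_inv hx]

end LevelSet

/-! ### The manifold of regular critical points -/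

section Submanifold

open Filter Topology

variable {X Z : Type*} [NormedAddCommGroup X] [NormedSpace ℝ X] [CompleteSpace X]
  [NormedAddCommGroup Z] [NormedSpace ℝ Z] [CompleteSpace Z] {n : ℕ}
  {ι : X →L[ℝ] Z} {hι : Function.Injective ι} {U : Set X}
  {V : Set (EuclideanSpace ℝ (Fin n))} {F : X × EuclideanSpace ℝ (Fin n) → Z}

theorem gradient_ne_zero_iff {f : EuclideanSpace ℝ (Fin n) → ℝ} {a : EuclideanSpace ℝ (Fin n)} :
    gradient f a ≠ 0 ↔ fderiv ℝ f a ≠ 0 := by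
  rw [gradient, Ne, map_eq_zero_iff _ (LinearIsometryEquiv.injective _)]

/-- Nearby critical points inherit their regularity from the same parametrization and eigenvalue
functions, merely based elsewhere. -/
theorem IsLocalParametrization.rebase {x₀ : X} {ε₀ ε : EuclideanSpace ℝ (Fin n)} {Nx : Set X}
    {Nε : Set (EuclideanSpace ℝ (Fin n))} {Xloc : EuclideanSpace ℝ (Fin n) → X}
    (h : IsLocalParametrization U V F x₀ ε₀ Nx Nε Xloc) (hε : ε ∈ Nε) :
    IsLocalParametrization U V F (Xloc ε) ε Nx Nε Xloc where
  isOpen_Nx := h.isOpen_Nx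
  isOpen_Nε := h.isOpen_Nε
  mem_Nx := h.mapsTo hε
  mem_Nε := hε
  Nx_subset := h.Nx_subset
  Nε_subset := h.Nε_subset
  analytic := h.analytic
  mapsTo := h.mapsTo
  base := rfl
  equilibria := h.equilibria

theorem IsPerturbedEigenvaluePair.rebase {ε₀ ε : EuclideanSpace ℝ (Fin n)}
    {Nε N₁ : Set (EuclideanSpace ℝ (Fin n))} {Xloc : EuclideanSpace ℝ (Fin n) → X}
    {lp lm : EuclideanSpace ℝ (Fin n) → ℂ}
    (h : IsPerturbedEigenvaluePair ι hι F ε₀ Nε Xloc N₁ lp lm) (hε : ε ∈ N₁)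
    (hre : (lp ε).re = 0) (him : 0 < (lp ε).im) (hconj : lm ε = starRingEnd ℂ (lp ε)) :
    IsPerturbedEigenvaluePair ι hι F ε Nε Xloc N₁ lp lm where
  isOpen := h.isOpen
  mem := hε
  subset := h.subset
  analytic_lp := h.analytic_lp
  analytic_lm := h.analytic_lm
  re_base := hre
  im_base := him
  conj_base := hconj
  simple_lp := h.simple_lp
  simple_lm := h.simple_lm

theorem isAnalyticSubmanifold_regular_critical (hn : 1 ≤ n) (hd : DenseRange ι)
    (hF : AnalyticOnNhd ℝ F (U ×ˢ V)) :
    IsAnalyticSubmanifold (n - 1)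
      {p : X × EuclideanSpace ℝ (Fin n) | IsCriticalPoint ι hι U V F p.1 p.2 ∧
        IsRRegular ι hι U V F p.1 p.2 ∧ IsHSectorial (linearization ι hι F p.1 p.2)} := by
  rintro ⟨x₀, ε₀⟩ ⟨hc, ⟨Nx, Nε, Xloc, N₁, lp, lm, hloc, hpair, hgrad⟩, hs⟩
  simp only at hc hloc hpair hgrad hs
  set r : EuclideanSpace ℝ (Fin n) → ℝ := fun ε => (lp ε).re with hr
  have hran : AnalyticAt ℝ r ε₀ :=
    (Complex.reCLM.analyticAt _).fun_comp (hpair.analytic_lp ε₀ hpair.mem)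
  have hr' := gradient_ne_zero_iff.1 hgrad
  have e1 : ∀ᶠ ε in 𝓝 ε₀, fderiv ℝ r ε ≠ 0 := hran.fderiv.continuousAt.eventually_ne hr'
  have e2 : ∀ᶠ ε in 𝓝 ε₀, 0 < (lp ε).im := by
    have : ContinuousAt (fun ε => (lp ε).im) ε₀ :=
      Complex.continuous_im.continuousAt.comp (hpair.analytic_lp ε₀ hpair.mem).continuousAt
    exact this.eventually (lt_mem_nhds hpair.im_base)
  have e3 : ∀ᶠ ε in 𝓝 ε₀, ε ∈ N₁ := hpair.isOpen.mem_nhds hpair.mem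
  have hall := (hloc.eventually_isCriticalPoint_iff hd hF hc hs hpair).and
    ((hloc.eventually_isHSectorial (hι := hι) hd hF hs).and (e1.and (e2.and e3)))
  obtain ⟨N', Ω, g, π, hN'o, haN', hN'N, hΩ, hg, hπ, himg⟩ :=
    exists_analytic_parametrization_zeroSet hn hran hr' hall
  have hgN' : ∀ t ∈ Ω, g t ∈ N' ∧ r (g t) = 0 := fun t ht => by
    have : g t ∈ {x ∈ N' | r x = 0} := himg ▸ mem_image_of_mem g ht
    exact this
  have hN'ε : ∀ ε ∈ N', ε ∈ Nε := fun ε hε => hpair.subset (hN'N hε).2.2.2.2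
  set φ : EuclideanSpace ℝ (Fin (n - 1)) → X × EuclideanSpace ℝ (Fin n) :=
    fun t => (Xloc (g t), g t) with hφ
  have hφan : AnalyticOnNhd ℝ φ Ω := fun t ht =>
    ((hloc.analytic _ (hN'ε _ (hgN' t ht).1)).fun_comp (hg t ht)).prod (hg t ht)
  -- A continuous linear left inverse of `φ` on `Ω`; it gives injectivity of the derivative and the
  -- embedding property at once.
  set P : X × EuclideanSpace ℝ (Fin n) →L[ℝ] EuclideanSpace ℝ (Fin (n - 1)) :=
    π ∘L ContinuousLinearMap.snd ℝ X _ with hP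
  have hPφ : ∀ t ∈ Ω, P (φ t) = t := hπ
  refine ⟨Nx ×ˢ N', Ω, φ, hloc.isOpen_Nx.prod hN'o, ⟨hloc.mem_Nx, haN'⟩, hΩ, hφan, ?_, ?_, ?_⟩
  · intro t ht
    have h1 : HasFDerivAt (fun t => P (φ t)) (P ∘L fderiv ℝ φ t) t :=
      P.hasFDerivAt.comp t (hφan t ht).differentiableAt.hasFDerivAt
    have h2 : HasFDerivAt (fun t => P (φ t))
        (ContinuousLinearMap.id ℝ (EuclideanSpace ℝ (Fin (n - 1)))) t := by
      refine (hasFDerivAt_id t).congr_of_eventuallyEq ?_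
      filter_upwards [hΩ.mem_nhds ht] with t' ht' using hPφ t' ht'
    have h3 := h1.unique h2
    refine Function.LeftInverse.injective (g := P) fun v => ?_
    exact DFunLike.congr_fun h3 v
  · have hcomp : P ∘ Ω.domRestrict φ = Subtype.val := by
      funext t
      exact hPφ t t.2
    refine Topology.IsEmbedding.of_comp
      (continuousOn_iff_continuous_domRestrict.1 hφan.continuousOn) P.continuous ?_
    rw [hcomp]
    exact Topology.IsEmbedding.subtypeVal
  · ext ⟨x, ε⟩
    constructor
    · rintro ⟨t, ht, hte⟩
      obtain ⟨rfl, rfl⟩ := Prod.mk.inj hte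
      obtain ⟨hgt, hrt⟩ := hgN' t ht
      obtain ⟨⟨hconj, hiff⟩, hsec, hd', him, hN₁⟩ := hN'N hgt
      have hNε := hN'ε _ hgt
      exact ⟨⟨hiff.2 hrt, ⟨Nx, Nε, Xloc, N₁, lp, lm, hloc.rebase hNε,
        hpair.rebase hN₁ hrt him hconj, gradient_ne_zero_iff.2 hd'⟩, hsec⟩, hloc.mapsTo hNε, hgt⟩
    -- Criticality alone suffices: being an equilibrium puts the point on the graph, and then `𝔯`
    -- vanishes.
    · rintro ⟨⟨hcx, -, -⟩, hx, hε⟩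
      simp only at hcx hx hε
      have hxe : x = Xloc ε := (hloc.equilibria x hx ε (hN'ε ε hε)).1 hcx.2.2.1
      subst hxe
      have hrε : r ε = 0 := ((hN'N hε).1.2).1 hcx
      obtain ⟨t, ht, rfl⟩ : ε ∈ g '' Ω := by rw [himg]; exact ⟨hε, hrε⟩
      exact ⟨t, ht, rfl⟩

end Submanifold

end HopfSpec

end

/-! ### The proposition -/

theorem propositionp {X Z : Type*}
    [NormedAddCommGroup X] [NormedSpace ℝ X] [CompleteSpace X]
    [NormedAddCommGroup Z] [NormedSpace ℝ Z] [CompleteSpace Z]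
    {n : ℕ} (hn : 1 ≤ n)
    (ι : X →L[ℝ] Z) (hι : Function.Injective ι) (hdense : DenseRange ι)
    (U : Set X) (hU : IsOpen U) (V : Set (EuclideanSpace ℝ (Fin n))) (hV : IsOpen V)
    (F : X × EuclideanSpace ℝ (Fin n) → Z) (hF : AnalyticOnNhd ℝ F (U ×ˢ V)) :
    (∀ (x₀ : X) (ε₀ : EuclideanSpace ℝ (Fin n)), IsCriticalPoint ι hι U V F x₀ ε₀ →
      (∃ (Nx : Set X) (Nε : Set (EuclideanSpace ℝ (Fin n)))
        (Xloc : EuclideanSpace ℝ (Fin n) → X),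
        IsLocalParametrization U V F x₀ ε₀ Nx Nε Xloc) ∧
      ∀ (Nx : Set X) (Nε : Set (EuclideanSpace ℝ (Fin n)))
        (Xloc : EuclideanSpace ℝ (Fin n) → X),
        IsLocalParametrization U V F x₀ ε₀ Nx Nε Xloc →
        (∃ (N₁ : Set (EuclideanSpace ℝ (Fin n))) (lp lm : EuclideanSpace ℝ (Fin n) → ℂ),
          IsPerturbedEigenvaluePair ι hι F ε₀ Nε Xloc N₁ lp lm) ∧
        (IsHSectorial (linearization ι hι F x₀ ε₀) →
          (∃ N₂ : Set (EuclideanSpace ℝ (Fin n)), IsOpen N₂ ∧ ε₀ ∈ N₂ ∧ N₂ ⊆ Nε ∧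
            ∀ ε ∈ N₂, IsHSectorial (linearization ι hι F (Xloc ε) ε)) ∧
          ∀ (N₁ : Set (EuclideanSpace ℝ (Fin n))) (lp lm : EuclideanSpace ℝ (Fin n) → ℂ),
            IsPerturbedEigenvaluePair ι hι F ε₀ Nε Xloc N₁ lp lm →
            ∃ N₃ : Set (EuclideanSpace ℝ (Fin n)), IsOpen N₃ ∧ ε₀ ∈ N₃ ∧ N₃ ⊆ N₁ ∧
              ∀ ε ∈ N₃, lm ε = starRingEnd ℂ (lp ε) ∧
                (IsCriticalPoint ι hι U V F (Xloc ε) ε ↔ (lp ε).re = 0))) ∧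
    IsAnalyticSubmanifold (n - 1)
      {p : X × EuclideanSpace ℝ (Fin n) | IsCriticalPoint ι hι U V F p.1 p.2 ∧
        IsRRegular ι hι U V F p.1 p.2 ∧ IsHSectorial (linearization ι hι F p.1 p.2)} := by
  refine ⟨fun x₀ ε₀ hc => ⟨?_, fun Nx Nε Xloc hloc => ⟨?_, fun hs => ⟨?_, ?_⟩⟩⟩,
    isAnalyticSubmanifold_regular_critical hn hdense hF⟩
  · exact exists_isLocalParametrization hU hV hc.1 hc.2.1 (hF _ ⟨hc.1, hc.2.1⟩) hc.2.2.1
      hc.bijective_fderiv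
  · exact hloc.exists_isPerturbedEigenvaluePair hF hc
  · obtain ⟨N₂, h, ho, hm⟩ := eventually_nhds_iff.1
      ((hloc.eventually_isHSectorial (hι := hι) hdense hF hs).and hloc.eventually_mem)
    exact ⟨N₂, ho, hm, fun ε hε => (h ε hε).2, fun ε hε => (h ε hε).1⟩
  · intro N₁ lp lm hpair
    have hN₁ : ∀ᶠ ε in nhds ε₀, ε ∈ N₁ := hpair.isOpen.mem_nhds hpair.mem
    obtain ⟨N₃, h, ho, hm⟩ := eventually_nhds_iff.1
      ((hloc.eventually_isCriticalPoint_iff hdense hF hc hs hpair).and hN₁)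
    exact ⟨N₃, ho, hm, fun ε hε => (h ε hε).2, fun ε hε => (h ε hε).1⟩
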